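/- Let $G$ be a second countable locally compact Abelian (Hausdorff) group with Haar measure written $|\cdot|$ and $dt$, and dual group $\widehat G$. A measure on $G$ is a complex Radon measure, i.e. a linear functional $\mu$ on $C_c(G)$ such that for each compact $K\subseteq G$ there is a constant $C_K$ with $|\mu(\varphi)|\le C_K\|\varphi\|_\infty$ whenever $\operatorname{supp}\varphi\subseteq K$. Such a $\mu$ is a linear combination of positive regular Borel measures, and $|\mu|$ denotes its total variation. It is translation bounded, $\mu\in\mathcal M^\infty(G)$, if $\sup_{t\in G}|\mu|(t+K)<\infty$ for all compact $K\subseteq G$. Put $\tilde\varphi(x)=\overline{\varphi(-x)}$ and $\tilde\mu(\varphi)=\overline{\mu(\tilde\varphi)}$ for $\varphi\in C_c(G)$, and $(\varphi*\mu)(t)=\int_G\varphi(t-s)\,d\mu(s)$. Let $\mathcal A=(A_n)$ be a van Hove sequence: compact sets $A_n\subseteq G$ with $|A_n|>0$ and $\lim_n|\partial^KA_n|/|A_n|=0$ for every compact $K\subseteq G$, where $\partial^KA=(\overline{A+K}\setminus A)\cup(((G\setminus A)-K)\cap\overline A)$. A bounded uniformly continuous function $f:G\to\mathbb C$ is Besicovitch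 almost periodic along $\mathcal A$ if for every $\varepsilon>0$ there is a trigonometric polynomial $P$ (a finite complex linear combination of characters $\chi\in\widehat G$) with $\limsup_n\frac1{|A_n|}\int_{A_n}|f(t)-P(t)|\,dt<\varepsilon$. A measure $\mu\in\mathcal M^\infty(G)$ is Besicovitch almost periodic along $\mathcal A$ if $\varphi*\mu$ is so for every $\varphi\in C_c(G)$. For $\mu\in\mathcal M^\infty(G)$ and $\chi\in\widehat G$, the Fourier–Bohr coefficient is $c_\chi^{\mathcal A}(\mu)=\lim_n\frac1{|A_n|}\int_{A_n}\overline{\chi(t)}\,d\mu(t)$, if the limit exists, and $\mathrm{FB}_{\mathcal A}(\mu)$ is the set of all $\chi\in\widehat G$ for which $c_\chi^{\mathcal A}(\mu)$ exists and is non-zero. The measure $\mu$ has null Fourier–Bohr spectrum along $\mathcal A$ if $c_\chi^{\mathcal A}(\mu)$ exists for all $\chi\in\widehat G$ and $\mathrm{FB}_{\mathcal A}(\mu)=\emptyset$. For $\mu,\nu\in\mathcal M^\infty(G)$ the Eberlein convolution $\mu\circledast_{\mathcal A}\nu$ is the vague limit $\lim_n\frac1{|A_n|}\,\mu|_{A_n}*\nu|_{-A_n}$,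 if it exists, where $(\mu|_{A_n}*\nu|_{-A_n})(\varphi)=\int_{-A_n}\int_{A_n}\varphi(s+t)\,d\mu(s)\,d\nu(t)$ for $\varphi\in C_c(G)$. **Proposition.** Let $\mu\in\mathcal M^\infty(G)$ be Besicovitch almost periodic along the van Hove sequence $\mathcal A$. If $\nu\in\mathcal M^\infty(G)$ is such that for every $\chi\in\mathrm{FB}_{\mathcal A}(\mu)$ the Fourier–Bohr coefficient $c_\chi^{\mathcal A}(\nu)$ exists and equals $0$, then the following Eberlein convolutions exist and $$\mu\circledast_{\mathcal A}\tilde\nu=\nu\circledast_{\mathcal A}\tilde\mu=0 .$$ In particular, both Eberlein convolutions exist and vanish for every $\nu\in\mathcal M^\infty(G)$ with null Fourier–Bohr spectrum along $\mathcal A$. -/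

import Mathlib

open MeasureTheory Filter Topology
open scoped NNReal ENNReal Pointwise CompactlySupported ComplexConjugate

noncomputable section

namespace EberleinConv

/-! ### Complex Radon measures as linear functionals on `C_c(X, ℂ)` -/

/-- A (complex) Radon measure: a linear functional on `C_c(X, ℂ)` such that for every compact `K`
there is a constant `C` with `|μ(φ)| ≤ C ‖φ‖_∞` for all `φ` with support in `K`. -/
structure RadonMeasure (X : Type*) [TopologicalSpace X] where
  toLinearMap : C_c(X, ℂ) →ₗ[ℂ] ℂ
  exists_bound : ∀ K : Set X, IsCompact K → ∃ C : ℝ, ∀ φ : C_c(X, ℂ),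
    tsupport φ ⊆ K → ‖toLinearMap φ‖ ≤ C * ⨆ x, ‖φ x‖

namespace RadonMeasure

section Variation

variable {X : Type*} [TopologicalSpace X]

instance : CoeFun (RadonMeasure X) (fun _ => C_c(X, ℂ) → ℂ) := ⟨fun μ => μ.toLinearMap⟩

instance : Zero (RadonMeasure X) := ⟨⟨0, fun _ _ => ⟨0, fun φ _ => by simp⟩⟩⟩

@[simp] theorem zero_apply (φ : C_c(X, ℂ)) : (0 : RadonMeasure X) φ = 0 := rfl

/-- A non-negative test function regarded as a complex-valued one. -/
def toComplex (φ : C_c(X, ℝ≥0)) : C_c(X, ℂ) where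
  toFun x := ((φ x : ℝ) : ℂ)
  continuous_toFun := by fun_prop
  hasCompactSupport' := φ.hasCompactSupport.comp_left (g := fun r : ℝ≥0 => ((r : ℝ) : ℂ)) (by simp)

@[simp] theorem toComplex_apply (φ : C_c(X, ℝ≥0)) (x : X) : toComplex φ x = ((φ x : ℝ) : ℂ) := rfl

/-- The set `{ |μ(ψ)| : ψ ∈ C_c, |ψ| ≤ φ }`. -/
def variationSet (μ : RadonMeasure X) (φ : C_c(X, ℝ≥0)) : Set ℝ :=
  {r | ∃ ψ : C_c(X, ℂ), (∀ x, ‖ψ x‖ ≤ φ x) ∧ ‖μ ψ‖ = r}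

/-- The total variation `|μ|(φ) = sup { |μ(ψ)| : ψ ∈ C_c, |ψ| ≤ φ }` for `φ ≥ 0`. -/
def variationValue (μ : RadonMeasure X) (φ : C_c(X, ℝ≥0)) : ℝ := sSup (μ.variationSet φ)

theorem zero_mem_variationSet (μ : RadonMeasure X) (φ : C_c(X, ℝ≥0)) : (0 : ℝ) ∈ μ.variationSet φ :=
  ⟨0, by simp, by simp⟩

theorem bddAbove_variationSet (μ : RadonMeasure X) (φ : C_c(X, ℝ≥0)) :
    BddAbove (μ.variationSet φ) := by
  obtain ⟨C, hC⟩ := μ.exists_bound (tsupport φ) φ.hasCompactSupport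
  obtain ⟨M, hM⟩ := (toComplex φ).hasCompactSupport.exists_bound_of_continuous
    (map_continuous (toComplex φ))
  rcases isEmpty_or_nonempty X with hX | ⟨⟨x₀⟩⟩
  · refine ⟨0, ?_⟩
    rintro r ⟨ψ, -, rfl⟩
    have : ψ = 0 := by ext x; exact hX.elim x
    simp [this]
  have hM0 : 0 ≤ M := (norm_nonneg _).trans (hM x₀)
  refine ⟨|C| * M, ?_⟩
  rintro r ⟨ψ, hψ, rfl⟩
  have hs : tsupport ψ ⊆ tsupport φ := by
    apply closure_mono
    intro x hx
    simp only [Function.mem_support] at hx ⊢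
    intro h0
    apply hx
    have := hψ x
    rw [h0] at this
    simpa using this
  have hle : ∀ x, ‖ψ x‖ ≤ M := fun x => (hψ x).trans (by simpa using hM x)
  have h0 : 0 ≤ ⨆ x, ‖ψ x‖ := Real.iSup_nonneg fun _ => norm_nonneg _
  have : Nonempty X := ⟨x₀⟩
  have h1 : ⨆ x, ‖ψ x‖ ≤ M := ciSup_le hle
  calc ‖μ ψ‖ ≤ C * ⨆ x, ‖ψ x‖ := hC ψ hs
    _ ≤ |C| * ⨆ x, ‖ψ x‖ := by gcongr; exact le_abs_self C
    _ ≤ |C| * M := by gcongr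

theorem le_variationValue (μ : RadonMeasure X) {φ : C_c(X, ℝ≥0)} {ψ : C_c(X, ℂ)}
    (h : ∀ x, ‖ψ x‖ ≤ φ x) : ‖μ ψ‖ ≤ μ.variationValue φ :=
  le_csSup (μ.bddAbove_variationSet φ) ⟨ψ, h, rfl⟩

theorem variationValue_nonneg (μ : RadonMeasure X) (φ : C_c(X, ℝ≥0)) : 0 ≤ μ.variationValue φ :=
  le_csSup (μ.bddAbove_variationSet φ) (μ.zero_mem_variationSet φ)

theorem variationValue_le (μ : RadonMeasure X) {φ : C_c(X, ℝ≥0)} {b : ℝ}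
    (h : ∀ ψ : C_c(X, ℂ), (∀ x, ‖ψ x‖ ≤ φ x) → ‖μ ψ‖ ≤ b) : μ.variationValue φ ≤ b := by
  refine csSup_le ⟨0, μ.zero_mem_variationSet φ⟩ ?_
  rintro r ⟨ψ, hψ, rfl⟩
  exact h ψ hψ

/-- A scalar of modulus one that rotates `z` onto the non-negative real axis. -/
theorem exists_rotation (z : ℂ) : ∃ u : ℂ, ‖u‖ = 1 ∧ u * z = (‖z‖ : ℂ) := by
  rcases eq_or_ne z 0 with rfl | hz
  · exact ⟨1, by simp, by simp⟩
  · have hn : (‖z‖ : ℂ) ≠ 0 := by simpa using hz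
    refine ⟨(‖z‖ : ℂ) / z, ?_, by field_simp⟩
    rw [norm_div, Complex.norm_real, norm_norm, div_self (by simpa using hz)]

theorem variationValue_add (μ : RadonMeasure X) (φ₁ φ₂ : C_c(X, ℝ≥0)) :
    μ.variationValue (φ₁ + φ₂) = μ.variationValue φ₁ + μ.variationValue φ₂ := by
  apply le_antisymm
  · refine μ.variationValue_le fun ψ hψ => ?_
    have key : ∀ φ : C_c(X, ℝ≥0), (∀ x, φ x ≤ φ₁ x + φ₂ x) →
        ∃ ψ' : C_c(X, ℂ), ∀ x,
          ψ' x = ψ x * (((φ x : ℝ) : ℂ) / (((φ₁ x + φ₂ x : ℝ≥0) : ℝ) : ℂ)) := by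
      intro φ hφ
      have hcont : Continuous fun x =>
          ψ x * (((φ x : ℝ) : ℂ) / (((φ₁ x + φ₂ x : ℝ≥0) : ℝ) : ℂ)) := by
        rw [continuous_iff_continuousAt]
        intro x
        by_cases hx : φ₁ x + φ₂ x = 0
        · have hψx : ψ x = 0 := by
            have := hψ x
            rw [CompactlySupportedContinuousMap.add_apply, hx] at this
            simpa using this
          unfold ContinuousAt
          beta_reduce
          rw [hψx, zero_mul]
          have hlim : Tendsto (fun y => ‖ψ y‖) (𝓝 x) (𝓝 0) := by
            have := ((map_continuous ψ).norm).tendsto x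
            rwa [hψx, norm_zero] at this
          refine squeeze_zero_norm (fun y => ?_) hlim
          rw [norm_mul, norm_div, Complex.norm_real, Complex.norm_real]
          refine mul_le_of_le_one_right (norm_nonneg _) ?_
          rw [Real.norm_of_nonneg (NNReal.coe_nonneg _), Real.norm_of_nonneg (NNReal.coe_nonneg _)]
          exact div_le_one_of_le₀ (by exact_mod_cast hφ y) (NNReal.coe_nonneg _)
        · have hx' : (((φ₁ x + φ₂ x : ℝ≥0) : ℝ) : ℂ) ≠ 0 := by exact_mod_cast hx
          refine ContinuousAt.mul (by fun_prop) (ContinuousAt.div (by fun_prop) ?_ hx')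
          have : Continuous fun x => (((φ₁ x + φ₂ x : ℝ≥0) : ℝ) : ℂ) := by fun_prop
          exact this.continuousAt
      exact ⟨⟨⟨_, hcont⟩, ψ.hasCompactSupport.mul_right⟩, fun x => rfl⟩
    have bd : ∀ (φ : C_c(X, ℝ≥0)) (ψ' : C_c(X, ℂ)), (∀ x,
        ψ' x = ψ x * (((φ x : ℝ) : ℂ) / (((φ₁ x + φ₂ x : ℝ≥0) : ℝ) : ℂ))) →
        ∀ x, ‖ψ' x‖ ≤ φ x := by
      intro φ ψ' h x
      have hx := hψ x
      rw [CompactlySupportedContinuousMap.add_apply] at hx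
      rw [h, norm_mul, norm_div, Complex.norm_real, Complex.norm_real,
        Real.norm_of_nonneg (NNReal.coe_nonneg _), Real.norm_of_nonneg (NNReal.coe_nonneg _)]
      rcases eq_or_ne (φ₁ x + φ₂ x) 0 with h0 | h0
      · rw [h0]; simp
      · have hpos : (0 : ℝ) < ((φ₁ x + φ₂ x : ℝ≥0) : ℝ) := by
          exact_mod_cast pos_iff_ne_zero.mpr h0
        rw [mul_div_assoc', div_le_iff₀ hpos, mul_comm]
        exact mul_le_mul_of_nonneg_left hx (NNReal.coe_nonneg _)
    obtain ⟨ψ₁, h₁⟩ := key φ₁ fun x => le_self_add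
    obtain ⟨ψ₂, h₂⟩ := key φ₂ fun x => le_add_self
    have hsum : ψ = ψ₁ + ψ₂ := by
      ext x
      rw [CompactlySupportedContinuousMap.add_apply, h₁, h₂]
      rcases eq_or_ne (φ₁ x + φ₂ x) 0 with h0 | h0
      · have hx := hψ x
        rw [CompactlySupportedContinuousMap.add_apply, h0] at hx
        have : ψ x = 0 := by simpa using hx
        simp [this]
      · have hx' : (((φ₁ x + φ₂ x : ℝ≥0) : ℝ) : ℂ) ≠ 0 := by exact_mod_cast h0
        rw [← mul_add, ← add_div]
        have : ((φ₁ x : ℝ) : ℂ) + ((φ₂ x : ℝ) : ℂ) = (((φ₁ x + φ₂ x : ℝ≥0) : ℝ) : ℂ) := by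
          push_cast; rfl
        rw [this, div_self hx', mul_one]
    calc ‖μ ψ‖ = ‖μ ψ₁ + μ ψ₂‖ := by rw [hsum, map_add]
      _ ≤ ‖μ ψ₁‖ + ‖μ ψ₂‖ := norm_add_le _ _
      _ ≤ _ := add_le_add (μ.le_variationValue (bd _ _ h₁)) (μ.le_variationValue (bd _ _ h₂))
  · rw [← le_sub_iff_add_le]
    refine μ.variationValue_le fun ψ₁ h₁ => ?_
    rw [le_sub_comm]
    refine μ.variationValue_le fun ψ₂ h₂ => ?_
    rw [le_sub_iff_add_le']
    obtain ⟨u₁, hu₁, e₁⟩ := exists_rotation (μ ψ₁)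
    obtain ⟨u₂, hu₂, e₂⟩ := exists_rotation (μ ψ₂)
    have hle : ∀ x, ‖(u₁ • ψ₁ + u₂ • ψ₂) x‖ ≤ (φ₁ + φ₂) x := by
      intro x
      refine (norm_add_le _ _).trans ?_
      rw [CompactlySupportedContinuousMap.add_apply, NNReal.coe_add]
      refine add_le_add ?_ ?_
      · simpa [norm_smul, hu₁] using h₁ x
      · simpa [norm_smul, hu₂] using h₂ x
    have := μ.le_variationValue hle
    rw [map_add, map_smul, map_smul, smul_eq_mul, smul_eq_mul, e₁, e₂, ← Complex.ofReal_add,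
      Complex.norm_real, Real.norm_of_nonneg (by positivity)] at this
    exact this

theorem variationValue_smul (μ : RadonMeasure X) (c : ℝ≥0) (φ : C_c(X, ℝ≥0)) :
    μ.variationValue (c • φ) = c * μ.variationValue φ := by
  have h1 : ∀ (c : ℝ≥0) (φ : C_c(X, ℝ≥0)), c ≠ 0 →
      μ.variationValue (c • φ) ≤ c * μ.variationValue φ := by
    intro c φ hc
    refine μ.variationValue_le fun ψ hψ => ?_
    have hc' : (0 : ℝ) < c := by exact_mod_cast pos_iff_ne_zero.mpr hc
    have hcc : ((c : ℝ) : ℂ) ≠ 0 := by exact_mod_cast hc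
    have hle : ∀ x, ‖((((c : ℝ) : ℂ)⁻¹) • ψ) x‖ ≤ φ x := by
      intro x
      have := hψ x
      rw [CompactlySupportedContinuousMap.smul_apply, smul_eq_mul, NNReal.coe_mul] at this
      rw [CompactlySupportedContinuousMap.smul_apply, norm_smul, norm_inv, Complex.norm_real,
        Real.norm_of_nonneg hc'.le, inv_mul_le_iff₀ hc']
      exact this
    have := μ.le_variationValue hle
    rw [map_smul, norm_smul, norm_inv, Complex.norm_real,
        Real.norm_of_nonneg hc'.le, inv_mul_le_iff₀ hc'] at this
    exact this
  rcases eq_or_ne c 0 with rfl | hc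
  · rw [zero_smul, NNReal.coe_zero, zero_mul]
    refine le_antisymm (μ.variationValue_le fun ψ hψ => ?_) (μ.variationValue_nonneg _)
    have : ψ = 0 := by
      ext x
      simpa using hψ x
    simp [this]
  · refine le_antisymm (h1 c φ hc) ?_
    have := h1 c⁻¹ (c • φ) (inv_ne_zero hc)
    rw [smul_smul, inv_mul_cancel₀ hc, one_smul, NNReal.coe_inv] at this
    have hc' : (0 : ℝ) < c := by exact_mod_cast pos_iff_ne_zero.mpr hc
    rwa [inv_mul_eq_div, le_div_iff₀ hc', mul_comm] at this

/-- The positive functional `φ ↦ |μ|(φ)`; the value is non-negative, so that `Real.toNNReal` only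
changes its type. -/
def variationFunctional (μ : RadonMeasure X) : C_c(X, ℝ≥0) →ₗ[ℝ≥0] ℝ≥0 where
  toFun φ := (μ.variationValue φ).toNNReal
  map_add' φ₁ φ₂ := by
    rw [variationValue_add, Real.toNNReal_add (variationValue_nonneg _ _)
      (variationValue_nonneg _ _)]
  map_smul' c φ := by
    rw [variationValue_smul, Real.toNNReal_mul c.coe_nonneg, Real.toNNReal_coe]
    rfl

theorem coe_variationFunctional (μ : RadonMeasure X) (φ : C_c(X, ℝ≥0)) :
    (μ.variationFunctional φ : ℝ) = μ.variationValue φ :=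
  Real.coe_toNNReal _ (μ.variationValue_nonneg φ)

theorem variationValue_add_re_nonneg (μ : RadonMeasure X) (w : ℂ) (hw : ‖w‖ = 1)
    (φ : C_c(X, ℝ≥0)) : 0 ≤ μ.variationValue φ + (w * μ (toComplex φ)).re := by
  have h1 : ‖μ (toComplex φ)‖ ≤ μ.variationValue φ :=
    μ.le_variationValue fun x => by simp
  have h2 := Complex.abs_re_le_norm (w * μ (toComplex φ))
  rw [norm_mul, hw, one_mul] at h2
  have h3 := neg_abs_le (w * μ (toComplex φ)).re
  linarith

/-- For `|w| = 1`, the positive functional `φ ↦ |μ|(φ) + Re (w μ(φ))`; again the value is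
non-negative. -/
def shiftedFunctional (μ : RadonMeasure X) (w : ℂ) (hw : ‖w‖ = 1) :
    C_c(X, ℝ≥0) →ₗ[ℝ≥0] ℝ≥0 where
  toFun φ := (μ.variationValue φ + (w * μ (toComplex φ)).re).toNNReal
  map_add' φ₁ φ₂ := by
    rw [← Real.toNNReal_add (μ.variationValue_add_re_nonneg w hw _)
      (μ.variationValue_add_re_nonneg w hw _)]
    have : toComplex (φ₁ + φ₂) = toComplex φ₁ + toComplex φ₂ := by ext x; simp
    rw [this, variationValue_add, map_add, mul_add, Complex.add_re]
    congr 1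
    ring
  map_smul' c φ := by
    have : toComplex (c • φ) = ((c : ℝ) : ℂ) • toComplex φ := by ext x; simp
    rw [this, variationValue_smul, map_smul, smul_eq_mul, mul_left_comm, Complex.re_ofReal_mul,
      ← mul_add, Real.toNNReal_mul c.coe_nonneg, Real.toNNReal_coe]
    rfl

theorem coe_shiftedFunctional (μ : RadonMeasure X) (w : ℂ) (hw : ‖w‖ = 1) (φ : C_c(X, ℝ≥0)) :
    (μ.shiftedFunctional w hw φ : ℝ) = μ.variationValue φ + (w * μ (toComplex φ)).re :=
  Real.coe_toNNReal _ (μ.variationValue_add_re_nonneg w hw φ)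

end Variation

section Integral

variable {X : Type*} [TopologicalSpace X] [T2Space X] [LocallyCompactSpace X] [MeasurableSpace X]
  [BorelSpace X]

/-- The total variation measure `|μ|`, as a positive regular Borel measure. -/
def variation (μ : RadonMeasure X) : Measure X := NNRealRMK.rieszMeasure μ.variationFunctional

/-- The positive regular Borel measure `|μ| + Re μ`. -/
def rePlus (μ : RadonMeasure X) : Measure X :=
  NNRealRMK.rieszMeasure (μ.shiftedFunctional 1 (by simp))

/-- The positive regular Borel measure `|μ| + Im μ`. -/
def imPlus (μ : RadonMeasure X) : Measure X :=
  NNRealRMK.rieszMeasure (μ.shiftedFunctional (-Complex.I) (by simp))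

instance (μ : RadonMeasure X) : μ.variation.Regular :=
  inferInstanceAs (NNRealRMK.rieszMeasure _).Regular

instance (μ : RadonMeasure X) : μ.rePlus.Regular :=
  inferInstanceAs (NNRealRMK.rieszMeasure _).Regular

instance (μ : RadonMeasure X) : μ.imPlus.Regular :=
  inferInstanceAs (NNRealRMK.rieszMeasure _).Regular

/-- `∫_S f dμ`, where `μ` is written as the linear combination
`(|μ| + Re μ) - |μ| + i ((|μ| + Im μ) - |μ|)` of positive regular Borel measures. -/
def setIntegral (μ : RadonMeasure X) (S : Set X) (f : X → ℂ) : ℂ :=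
  ((∫ x in S, f x ∂μ.rePlus) - ∫ x in S, f x ∂μ.variation) +
    Complex.I * ((∫ x in S, f x ∂μ.imPlus) - ∫ x in S, f x ∂μ.variation)

/-- `∫ f dμ`. -/
def integral (μ : RadonMeasure X) (f : X → ℂ) : ℂ := μ.setIntegral Set.univ f

/-- The integral of a test function against `μ` is the value of the functional. -/
theorem integral_eq_apply (μ : RadonMeasure X) (φ : C_c(X, ℂ)) : μ.integral φ = μ φ := by
  have hint : ∀ (m : Measure X) [m.Regular] (ψ : C_c(X, ℂ)), Integrable ψ m := fun m _ ψ =>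
    (map_continuous ψ).integrable_of_hasCompactSupport ψ.hasCompactSupport
  -- non-negative test functions
  have hpos : ∀ φ : C_c(X, ℝ≥0), μ.integral (toComplex φ) = μ (toComplex φ) := by
    intro φ
    have e : ∀ Λ : C_c(X, ℝ≥0) →ₗ[ℝ≥0] ℝ≥0,
        ∫ x, (toComplex φ) x ∂(NNRealRMK.rieszMeasure Λ) = ((Λ φ : ℝ) : ℂ) := by
      intro Λ
      simp only [toComplex_apply]
      rw [integral_complex_ofReal, NNRealRMK.integral_rieszMeasure]
    simp only [integral, setIntegral, Measure.restrict_univ, variation, rePlus, imPlus, e, coe_variationFunctional,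
      coe_shiftedFunctional]
    apply Complex.ext <;> simp
  have hadd : ∀ ψ₁ ψ₂ : C_c(X, ℂ),
      μ.integral (ψ₁ + ψ₂ : C_c(X, ℂ)) = μ.integral ψ₁ + μ.integral ψ₂ := by
    intro ψ₁ ψ₂
    simp only [integral, setIntegral, Measure.restrict_univ,
      CompactlySupportedContinuousMap.add_apply]
    rw [integral_add (hint _ _) (hint _ _), integral_add (hint _ _) (hint _ _),
      integral_add (hint _ _) (hint _ _)]
    ring
  have hsmul : ∀ (c : ℂ) (ψ : C_c(X, ℂ)),
      μ.integral (c • ψ : C_c(X, ℂ)) = c * μ.integral ψ := by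
    intro c ψ
    simp only [integral, setIntegral, Measure.restrict_univ,
      CompactlySupportedContinuousMap.smul_apply, smul_eq_mul, integral_const_mul]
    ring
  have part : ∀ (g : ℂ → ℝ≥0), Continuous g → g 0 = 0 →
      ∃ φ' : C_c(X, ℝ≥0), ∀ x, φ' x = g (φ x) := fun g hg h0 =>
    ⟨⟨⟨_, hg.comp (map_continuous φ)⟩, φ.hasCompactSupport.comp_left h0⟩, fun x => rfl⟩
  obtain ⟨a, ha⟩ := part (fun z => z.re.toNNReal) (by fun_prop) (by simp)
  obtain ⟨b, hb⟩ := part (fun z => (-z.re).toNNReal) (by fun_prop) (by simp)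
  obtain ⟨c, hc⟩ := part (fun z => z.im.toNNReal) (by fun_prop) (by simp)
  obtain ⟨d, hd⟩ := part (fun z => (-z.im).toNNReal) (by fun_prop) (by simp)
  have hφ : φ = (toComplex a + (-1 : ℂ) • toComplex b) +
      Complex.I • (toComplex c + (-1 : ℂ) • toComplex d) := by
    ext x
    have h (r : ℝ) : max r 0 - max (-r) 0 = r := by
      rcases le_total 0 r with h | h <;> simp [h]
    apply Complex.ext <;> simp [ha, hb, hc, hd, Real.coe_toNNReal', ← sub_eq_add_neg, h]
  rw [hφ]
  simp only [hadd, hsmul, hpos, map_add, map_smul, smul_eq_mul]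

end Integral

section Group

variable {G : Type*} [AddCommGroup G] [TopologicalSpace G] [IsTopologicalAddGroup G]

/-- `φ̃(x) = conj (φ (-x))` for a test function `φ`. -/
def tildeFun (φ : C_c(G, ℂ)) : C_c(G, ℂ) where
  toFun x := conj (φ (-x))
  continuous_toFun := by fun_prop
  hasCompactSupport' :=
    (φ.hasCompactSupport.comp_homeomorph (Homeomorph.neg G)).comp_left (g := fun z : ℂ => conj z)
      (by simp)

@[simp] theorem tildeFun_apply (φ : C_c(G, ℂ)) (x : G) : tildeFun φ x = conj (φ (-x)) := rfl

/-- `μ̃(φ) = conj (μ (φ̃))`. -/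
def tilde (μ : RadonMeasure G) : RadonMeasure G where
  toLinearMap :=
    { toFun := fun φ => conj (μ (tildeFun φ))
      map_add' := fun φ₁ φ₂ => by
        have : tildeFun (φ₁ + φ₂) = tildeFun φ₁ + tildeFun φ₂ := by ext x; simp
        rw [this, map_add, map_add]
      map_smul' := fun c φ => by
        have : tildeFun (c • φ) = conj c • tildeFun φ := by ext x; simp
        rw [this, map_smul, smul_eq_mul, map_mul]
        simp }
  exists_bound := fun K hK => by
    obtain ⟨C, hC⟩ := μ.exists_bound (-K) hK.neg
    refine ⟨C, fun φ hφ => ?_⟩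
    have hs : tsupport (tildeFun φ) ⊆ -K := by
      refine (closure_minimal (fun x hx => ?_) (isClosed_tsupport φ).neg).trans
        (Set.neg_subset_neg.mpr hφ)
      refine Set.mem_neg.mpr (subset_tsupport _ ?_)
      simp only [Function.mem_support, tildeFun_apply] at hx ⊢
      intro h0
      exact hx (by rw [h0, map_zero])
    have hsup : ⨆ x, ‖tildeFun φ x‖ = ⨆ x, ‖φ x‖ := by
      rw [← (Equiv.neg G).iSup_comp]
      simp
    have := hC (tildeFun φ) hs
    rw [hsup] at this
    simpa using this

end Group

end RadonMeasure

/-! ### Averages, Fourier–Bohr coefficients and Besicovitch almost periodicity -/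

section Averages

variable {G : Type*} [AddCommGroup G] [TopologicalSpace G]

/-- The `K`-boundary `∂^K A = (closure (A + K) \ A) ∪ (((G \ A) - K) ∩ closure A)`. -/
def kBoundary (K A : Set G) : Set G := (closure (A + K) \ A) ∪ ((Aᶜ - K) ∩ closure A)

/-- A van Hove sequence: compact sets `A n` of positive Haar measure with
`|∂^K (A n)| / |A n| → 0` for every compact `K`. -/
structure IsVanHove [MeasurableSpace G] (θ : Measure G) (A : ℕ → Set G) : Prop where
  isCompact : ∀ n, IsCompact (A n)
  measure_pos : ∀ n, 0 < θ (A n)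
  tendsto_boundary : ∀ K : Set G, IsCompact K →
    Tendsto (fun n => θ.real (kBoundary K (A n)) / θ.real (A n)) atTop (𝓝 0)

/-- The continuous characters of the additive group `G`, with values in the unit circle. -/
abbrev Dual (G : Type*) [AddCommGroup G] [TopologicalSpace G] : Type _ :=
  PontryaginDual (Multiplicative G)

/-- The value `χ(t)` as a complex number. -/
def charFun (χ : Dual G) (t : G) : ℂ := (χ (Multiplicative.ofAdd t) : ℂ)

/-- Trigonometric polynomials: finite complex linear combinations of continuous characters. -/
def IsTrigPoly (P : G → ℂ) : Prop :=
  P ∈ Submodule.span ℂ (Set.range (charFun : Dual G → G → ℂ))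

/-- Bounded and uniformly continuous functions on the topological group `G`. -/
def IsBUC (f : G → ℂ) : Prop :=
  (∃ C : ℝ, ∀ x, ‖f x‖ ≤ C) ∧
    ∀ ε > 0, ∃ U ∈ 𝓝 (0 : G), ∀ x y, x - y ∈ U → ‖f x - f y‖ < ε

variable [MeasurableSpace G]

/-- The Besicovitch `1`-seminorm along `A` of a bounded continuous function. -/
def besicovitchSeminorm (θ : Measure G) (A : ℕ → Set G) (f : G → ℂ) : ℝ :=
  limsup (fun n => (θ.real (A n))⁻¹ * ∫ t in A n, ‖f t‖ ∂θ) atTop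

/-- Besicovitch almost periodic functions along `A`. -/
def IsBesicovitchFun (θ : Measure G) (A : ℕ → Set G) (f : G → ℂ) : Prop :=
  IsBUC f ∧ ∀ ε > 0, ∃ P : G → ℂ, IsTrigPoly P ∧ besicovitchSeminorm θ A (f - P) < ε

end Averages

namespace RadonMeasure

variable {G : Type*} [AddCommGroup G] [TopologicalSpace G] [IsTopologicalAddGroup G] [T2Space G]
  [LocallyCompactSpace G] [MeasurableSpace G] [BorelSpace G]

/-- Translation boundedness: `sup_t |μ|(t + K) < ∞` for every compact `K`. -/
def IsTranslationBounded (μ : RadonMeasure G) : Prop :=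
  ∀ K : Set G, IsCompact K → (⨆ t : G, μ.variation ((fun x => t + x) '' K)) < ∞

/-- The convolution `(φ * μ)(t) = ∫ φ(t - s) dμ(s)`. -/
def convFun (φ : C_c(G, ℂ)) (μ : RadonMeasure G) (t : G) : ℂ := μ.integral fun s => φ (t - s)

/-- Besicovitch almost periodic measures along `A`: `φ * μ` is a Besicovitch almost periodic
function for every `φ ∈ C_c(G)`. -/
def IsBesicovitch (θ : Measure G) (A : ℕ → Set G) (μ : RadonMeasure G) : Prop :=
  ∀ φ : C_c(G, ℂ), IsBesicovitchFun θ A (convFun φ μ)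

/-- The Fourier–Bohr coefficient of `μ` at `χ` along `A` exists and is equal to `c`. -/
def HasFourierBohrCoeff (θ : Measure G) (A : ℕ → Set G) (μ : RadonMeasure G) (χ : Dual G)
    (c : ℂ) : Prop :=
  Tendsto (fun n => (θ.real (A n) : ℂ)⁻¹ * μ.setIntegral (A n) fun t => conj (charFun χ t))
    atTop (𝓝 c)

/-- The Fourier–Bohr spectrum of `μ` along `A`: the characters at which the Fourier–Bohr
coefficient exists and is non-zero. -/
def fourierBohrSpectrum (θ : Measure G) (A : ℕ → Set G) (μ : RadonMeasure G) : Set (Dual G) :=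
  {χ | ∃ c : ℂ, c ≠ 0 ∧ HasFourierBohrCoeff θ A μ χ c}

/-- The Fourier–Bohr spectrum of `μ` is well defined (all coefficients exist) and empty. -/
def HasNullFourierBohrSpectrum (θ : Measure G) (A : ℕ → Set G) (μ : RadonMeasure G) : Prop :=
  (∀ χ : Dual G, ∃ c : ℂ, HasFourierBohrCoeff θ A μ χ c) ∧ fourierBohrSpectrum θ A μ = ∅

/-- `(μ|_S * ν|_T)(φ) = ∫_T ∫_S φ(s + t) dμ(s) dν(t)`. -/
def restrictConv (μ : RadonMeasure G) (S : Set G) (ν : RadonMeasure G) (T : Set G)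
    (φ : C_c(G, ℂ)) : ℂ :=
  ν.setIntegral T fun t => μ.setIntegral S fun s => φ (s + t)

/-- The Eberlein convolution of `μ` and `ν` along `A` exists and is equal to `ρ`: the measures
`|A n|⁻¹ μ|_{A n} * ν|_{-A n}` converge vaguely to `ρ`. -/
def HasEberleinConv (θ : Measure G) (A : ℕ → Set G) (μ ν ρ : RadonMeasure G) : Prop :=
  ∀ φ : C_c(G, ℂ),
    Tendsto (fun n => (θ.real (A n) : ℂ)⁻¹ * restrictConv μ (A n) ν (-A n) φ) atTop (𝓝 (ρ φ))

end RadonMeasure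

end EberleinConv

end

/-! Unfolding the tilde turns the Eberlein average of `μ` and `ν.tilde` at `φ` into the conjugate of
|A_n|⁻¹ ∫_{A_n} conj(∫_{A_n} φ(s - t) dμ(s)) dν(t). Translation bounded measures are dominated by
Haar measure of thickenings, so the van Hove property makes boundary effects negligible. The inner
integral may therefore be extended to all of G, where it equals f(t) = (φ(-·) * μ)(t), a Besicovitch
almost periodic function. It remains to show that conj f has mean zero against ν
(`tendsto_average_conj_convFun`).

Since f is uniformly continuous, conj f is uniformly close to its average under an approximate unit
ψ. Up to another boundary term ψ can be moved onto ν (`tendsto_mean_mul_convFun_sub`), so the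
question becomes whether the Haar means of conj f · g vanish in the limit, where g = ψ * ν is a
bounded function. The Fourier–Bohr averages of g are asymptotic to those of ν times the Fourier
transform of ψ, and the spectrum of f lies in that of μ. So the coefficients of g vanish wherever
those of f do not.

The core is then an orthogonality statement (`IsBesicovitchFun.tendsto_mean_conj_mul`). An
approximating trigonometric polynomial Q of f may use frequencies at which nothing is known about g.
Replacing its coefficients by the Fourier–Bohr coefficients of f removes these frequencies, and in
mean square this projection does not worsen the approximation asymptotically. Mean square
approximation is available because f is bounded: truncating the L¹ approximant to the range of f
gives L² control, and Stone–Weierstrass makes the truncation a trigonometric polynomial again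
(`IsBesicovitchFun.exists_sq_approx`).

The second convolution needs nothing new: by Fubini its averages at φ are conjugates of the first
ones at the tilde of φ (`restrictConv_swap`). -/

set_option linter.unusedSectionVars false

namespace EberleinConv

/-! ### Translation bounded positive measures along van Hove sequences. -/

section PositiveMeasures

variable {G : Type*} [AddCommGroup G] [TopologicalSpace G] [IsTopologicalAddGroup G]
    [T2Space G] [LocallyCompactSpace G] [SecondCountableTopology G]
    [MeasurableSpace G] [BorelSpace G]

/-- Translation boundedness of a positive measure: the measures of the translates of a compact set
are bounded. -/
def TranslationBounded (m : Measure G) : Prop :=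
  ∀ K : Set G, IsCompact K → ∃ C : ℝ≥0, ∀ t : G, m ((fun x => t + x) '' K) ≤ C

theorem closure_add_eq {A K : Set G} (hA : IsCompact A) (hK : IsCompact K) :
    closure (A + K) = A + K := (hA.add hK).isClosed.closure_eq

theorem isCompact_sub {A K : Set G} (hA : IsCompact A) (hK : IsCompact K) : IsCompact (A - K) := by
  rw [sub_eq_add_neg]; exact hA.add hK.neg

theorem measurableSet_kBoundary {A K : Set G} (hA : IsCompact A) : MeasurableSet (kBoundary K A) := by
  have h : IsOpen (Aᶜ - K) := hA.isClosed.isOpen_compl.sub_right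
  exact (isClosed_closure.measurableSet.diff hA.isClosed.measurableSet).union
    (h.measurableSet.inter isClosed_closure.measurableSet)

theorem kBoundary_subset {A K : Set G} (hA : IsCompact A) (hK : IsCompact K) :
    kBoundary K A ⊆ (A + K) ∪ A := by
  rw [kBoundary, closure_add_eq hA hK, hA.isClosed.closure_eq]
  exact Set.union_subset_union Set.sdiff_subset Set.inter_subset_right

theorem kBoundary_lt_top {A K : Set G} (hA : IsCompact A) (hK : IsCompact K) (m : Measure G)
    [IsFiniteMeasureOnCompacts m] : m (kBoundary K A) < ∞ :=
  (measure_mono (kBoundary_subset hA hK)).trans_lt ((hA.add hK).union hA).measure_lt_top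

theorem mem_kBoundary_of_notMem {A K : Set G} {x : G} (h : x ∈ A + K) (hx : x ∉ A) :
    x ∈ kBoundary K A := Or.inl ⟨subset_closure h, hx⟩

theorem mem_kBoundary_of_mem {A K : Set G} {x : G} (h : x ∈ Aᶜ - K) (hx : x ∈ A) :
    x ∈ kBoundary K A := Or.inr ⟨h, subset_closure hx⟩

theorem IsVanHove.real_pos {θ : Measure G} [IsFiniteMeasureOnCompacts θ] {A : ℕ → Set G}
    (hA : IsVanHove θ A) (n : ℕ) : 0 < θ.real (A n) :=
  ENNReal.toReal_pos (hA.measure_pos n).ne' (hA.isCompact n).measure_lt_top.ne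

theorem sub_mem_iff_mem_image {K : Set G} {t s : G} :
    t - s ∈ K ↔ s ∈ (fun x => t + x) '' (-K) := by
  rw [Set.image_add_left, Set.mem_preimage, Set.mem_neg]
  simp [sub_eq_add_neg, add_comm]

/-- A translation bounded measure is dominated by the Haar measure of a thickening. -/
theorem TranslationBounded.measure_le {m : Measure G} [SFinite m] (hm : TranslationBounded m)
    (θ : Measure G) [θ.IsAddHaarMeasure] {V : Set G} (hV : IsCompact V) (hV0 : V ∈ 𝓝 (0 : G)) :
    ∃ C : ℝ≥0, ∀ S T : Set G, MeasurableSet S → MeasurableSet T → S + V ⊆ T → m S ≤ C * θ T := by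
  obtain ⟨C, hC⟩ := hm (-V) hV.neg
  have hθV : 0 < θ V := Measure.measure_pos_of_mem_nhds θ hV0
  have hθV' : θ V < ∞ := hV.measure_lt_top
  refine ⟨C / (θ V).toNNReal, fun S T hS hT hST => ?_⟩
  -- Integrate 1_V(t - s) over s ∈ S and t ∈ T in both orders. For fixed s the whole of s + V lies
  -- in T, which gives θ V; for fixed t the admissible s lie in t + (-V), which has m-measure at
  -- most C.
  have key : m S * θ V ≤ C * θ T := by
    have hVm : MeasurableSet V := hV.isClosed.measurableSet
    have hmeas : Measurable (Function.uncurry fun (s t : G) =>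
        T.indicator (fun _ => V.indicator (fun _ => (1 : ℝ≥0∞)) (t - s)) t) := by
      have : (Function.uncurry fun (s t : G) =>
        T.indicator (fun _ => V.indicator (fun _ => (1 : ℝ≥0∞)) (t - s)) t) =
        (((fun p : G × G => p.2) ⁻¹' T) ∩ ((fun p : G × G => p.2 - p.1) ⁻¹' V)).indicator
          (fun _ => 1) := by
        ext ⟨s, t⟩
        by_cases h1 : t ∈ T <;> by_cases h2 : t - s ∈ V <;> simp [h1, h2]
      rw [this]
      exact measurable_const.indicator ((measurable_snd hT).inter
        ((measurable_snd.sub measurable_fst) hVm))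
    calc m S * θ V = ∫⁻ _ in S, θ V ∂m := by simp [mul_comm]
      _ ≤ ∫⁻ s in S, ∫⁻ t, T.indicator (fun _ => V.indicator (fun _ => (1 : ℝ≥0∞)) (t - s)) t
            ∂θ ∂m := by
          refine setLIntegral_mono' hS fun s hs => ?_
          rw [← measure_preimage_add_right θ (-s) V, ← lintegral_indicator_one
            (show MeasurableSet ((fun h => h + -s) ⁻¹' V) from measurable_id.add_const (-s) hVm)]
          refine lintegral_mono fun t => ?_
          by_cases h2 : t - s ∈ V
          · have : t ∈ T := hST ⟨s, hs, t - s, h2, by simp⟩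
            simp [h2, this, ← sub_eq_add_neg]
          · simp [h2, ← sub_eq_add_neg]
      _ ≤ ∫⁻ s, ∫⁻ t, T.indicator (fun _ => V.indicator (fun _ => (1 : ℝ≥0∞)) (t - s)) t
            ∂θ ∂m := setLIntegral_le_lintegral _ _
      _ = ∫⁻ t, ∫⁻ s, T.indicator (fun _ => V.indicator (fun _ => (1 : ℝ≥0∞)) (t - s)) t
            ∂m ∂θ := lintegral_lintegral_swap hmeas.aemeasurable
      _ ≤ ∫⁻ t, T.indicator (fun _ => (C : ℝ≥0∞)) t ∂θ := by
          refine lintegral_mono fun t => ?_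
          by_cases h1 : t ∈ T
          · simp only [h1, Set.indicator_of_mem]
            have h3 : (fun s => V.indicator (fun _ => (1 : ℝ≥0∞)) (t - s)) =
                ((fun x => t + x) '' (-V)).indicator 1 := by
              ext s
              have : s ∈ (fun x => t + x) '' (-V) ↔ t - s ∈ V := sub_mem_iff_mem_image.symm
              by_cases h2 : t - s ∈ V
              · simp only [Set.indicator_of_mem h2, Set.indicator_of_mem (this.2 h2), Pi.one_apply]
              · rw [Set.indicator_of_notMem h2, Set.indicator_of_notMem (mt this.1 h2)]
            rw [h3, lintegral_indicator_one]
            · exact hC t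
            · exact (hV.neg.image (continuous_const.add continuous_id)).isClosed.measurableSet
          · simp [h1]
      _ = C * θ T := lintegral_indicator_const hT _
  have h0 : (θ V).toNNReal ≠ 0 := by
    simp [ENNReal.toNNReal_eq_zero_iff, hθV.ne', hθV'.ne]
  rw [ENNReal.coe_div h0, ENNReal.coe_toNNReal hθV'.ne, ENNReal.div_eq_inv_mul, mul_assoc,
    ← ENNReal.div_eq_inv_mul, ENNReal.le_div_iff_mul_le (Or.inl hθV.ne') (Or.inl hθV'.ne)]
  exact key

variable {θ : Measure G} [θ.IsAddHaarMeasure] {A : ℕ → Set G}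

theorem exists_isCompact_nhds_zero : ∃ V : Set G, IsCompact V ∧ V ∈ 𝓝 (0 : G) :=
  exists_compact_mem_nhds 0

/-- Holds because A_n + V is contained in A_n together with its V-boundary, whose Haar measure is
eventually at most |A_n|; hence the factor 2. -/
theorem IsVanHove.eventually_measure_le (hA : IsVanHove θ A) {m : Measure G} [SFinite m]
    (hm : TranslationBounded m) :
    ∃ C : ℝ, 0 ≤ C ∧ ∀ᶠ n in atTop, (θ.real (A n))⁻¹ * m.real (A n) ≤ C := by
  obtain ⟨V, hV, hV0⟩ := exists_isCompact_nhds_zero (G := G)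
  obtain ⟨C, hC⟩ := hm.measure_le θ hV hV0
  refine ⟨C * 2, by positivity, ?_⟩
  filter_upwards [(hA.tendsto_boundary V hV).eventually_le_const (show (0 : ℝ) < 1 by norm_num)]
    with n hn
  have hpos := hA.real_pos n
  have hfin := kBoundary_lt_top (hA.isCompact n) hV θ
  have hAfin := (hA.isCompact n).measure_lt_top (μ := θ)
  have h1 := hC (A n) (A n ∪ kBoundary V (A n)) (hA.isCompact n).isClosed.measurableSet
    ((hA.isCompact n).isClosed.measurableSet.union (measurableSet_kBoundary (hA.isCompact n)))
    (fun x hx => by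
      by_cases h : x ∈ A n
      · exact Or.inl h
      · exact Or.inr (mem_kBoundary_of_notMem hx h))
  have h2 : m.real (A n) ≤ C * (θ.real (A n) + θ.real (kBoundary V (A n))) := by
    have h3 : m (A n) ≤ C * (θ (A n) + θ (kBoundary V (A n))) :=
      h1.trans (by gcongr; exact measure_union_le _ _)
    have := ENNReal.toReal_mono
      (ENNReal.mul_ne_top ENNReal.coe_ne_top (ENNReal.add_lt_top.2 ⟨hAfin, hfin⟩).ne) h3
    rw [ENNReal.toReal_mul, ENNReal.toReal_add hAfin.ne hfin.ne] at this
    exact this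
  rw [div_le_iff₀ hpos, one_mul] at hn
  rw [inv_mul_le_iff₀ hpos]
  calc m.real (A n) ≤ C * (θ.real (A n) + θ.real (kBoundary V (A n))) := h2
    _ ≤ C * (θ.real (A n) + θ.real (A n)) := by gcongr
    _ = _ := by ring

/-- The van Hove condition concerns Haar measure only. It passes to m because thickening the inner
boundary by a compact V stays inside boundaries of A_n for larger compact sets. -/
theorem IsVanHove.tendsto_inner_boundary (hA : IsVanHove θ A) {m : Measure G} [SFinite m]
    (hm : TranslationBounded m) {K : Set G} (hK : IsCompact K) :
    Tendsto (fun n => (θ.real (A n))⁻¹ * m.real (((A n)ᶜ - K) ∩ A n)) atTop (𝓝 0) := by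
  obtain ⟨V, hV, hV0⟩ := exists_isCompact_nhds_zero (G := G)
  obtain ⟨C, hC⟩ := hm.measure_le θ hV hV0
  have hlim : Tendsto (fun n => C * (θ.real (kBoundary (K - V) (A n)) / θ.real (A n) +
      θ.real (kBoundary V (A n)) / θ.real (A n))) atTop (𝓝 0) := by
    have := ((hA.tendsto_boundary (K - V) (isCompact_sub hK hV)).add
      (hA.tendsto_boundary V hV)).const_mul (C : ℝ)
    simpa using this
  refine squeeze_zero (fun n => by positivity) (fun n => ?_) hlim
  have hAn := hA.isCompact n
  have hpos := hA.real_pos n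
  have hopen : IsOpen ((A n)ᶜ - K) := hAn.isClosed.isOpen_compl.sub_right
  have hf1 := kBoundary_lt_top hAn (isCompact_sub hK hV) θ
  have hf2 := kBoundary_lt_top hAn hV θ
  have h1 := hC (((A n)ᶜ - K) ∩ A n) (kBoundary (K - V) (A n) ∪ kBoundary V (A n))
    (hopen.measurableSet.inter hAn.isClosed.measurableSet)
    ((measurableSet_kBoundary hAn).union (measurableSet_kBoundary hAn)) (by
      -- For a outside A_n and a - k inside, the point a - k + v is either in A_n, hence in the (K -
      -- V)-boundary because it equals a - (k - v), or it has left A_n and lies in the V-boundary.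
      rintro _ ⟨b, ⟨⟨a, ha, k, hk, rfl⟩, hb⟩, v, hv, rfl⟩
      by_cases h : a - k + v ∈ A n
      · exact Or.inl (mem_kBoundary_of_mem ⟨a, ha, k - v, ⟨k, hk, v, hv, rfl⟩, by
          simp only [sub_sub_eq_add_sub]; abel⟩ h)
      · exact Or.inr (mem_kBoundary_of_notMem ⟨a - k, hb, v, hv, rfl⟩ h))
  have h3 := h1.trans (mul_le_mul_right (measure_union_le _ _) _)
  have h4 := ENNReal.toReal_mono
      (ENNReal.mul_ne_top ENNReal.coe_ne_top (ENNReal.add_lt_top.2 ⟨hf1, hf2⟩).ne) h3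
  rw [ENNReal.toReal_mul, ENNReal.toReal_add hf1.ne hf2.ne, ENNReal.coe_toReal] at h4
  rw [inv_mul_le_iff₀ hpos]
  refine h4.trans (le_of_eq ?_)
  have := hpos.ne'
  field_simp
  rfl

theorem isCompact_image_add {K : Set G} (hK : IsCompact K) (t : G) :
    IsCompact ((fun x => t + x) '' K) := hK.image (by fun_prop)

theorem exists_norm_le (ψ : C_c(G, ℂ)) : ∃ C : ℝ, 0 ≤ C ∧ ∀ x, ‖ψ x‖ ≤ C := by
  obtain ⟨C, hC⟩ := ψ.hasCompactSupport.exists_bound_of_continuous (map_continuous ψ)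
  exact ⟨C, (norm_nonneg _).trans (hC 0), hC⟩

/-- A uniform bound for integrals of functions dominated by a translate of a compact set. -/
theorem TranslationBounded.norm_integral_le {m : Measure G} [IsFiniteMeasureOnCompacts m]
    {K : Set G} (hK : IsCompact K) {C : ℝ≥0} (hC : ∀ t : G, m ((fun x => t + x) '' (-K)) ≤ C)
    {M : ℝ} (hM : 0 ≤ M) {h : G → ℂ} {t : G} (h0 : ∀ s, t - s ∉ K → h s = 0)
    (hb : ∀ s, ‖h s‖ ≤ M) : ‖∫ s, h s ∂m‖ ≤ M * C := by
  have hKt := isCompact_image_add hK.neg t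
  rw [← setIntegral_eq_integral_of_forall_compl_eq_zero (s := (fun x => t + x) '' (-K))
    (fun s hs => h0 s (fun h => hs (sub_mem_iff_mem_image.1 h)))]
  refine (norm_setIntegral_le_of_norm_le_const hKt.measure_lt_top fun s _ => hb s).trans ?_
  refine mul_le_mul_of_nonneg_left ?_ hM
  exact ENNReal.toReal_le_coe_of_le_coe (hC t)

theorem exists_norm_integral_convolution_le {m : Measure G} [IsFiniteMeasureOnCompacts m]
    (hm : TranslationBounded m) (ψ : C_c(G, ℂ)) :
    ∃ C : ℝ, ∀ t, ‖∫ s, ψ (t - s) ∂m‖ ≤ C := by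
  obtain ⟨M, hM, hψ⟩ := exists_norm_le ψ
  obtain ⟨C, hC⟩ := hm _ (IsCompact.neg ψ.hasCompactSupport)
  exact ⟨M * C, fun t => TranslationBounded.norm_integral_le ψ.hasCompactSupport hC hM
    (fun s hs => image_eq_zero_of_notMem_tsupport hs) fun s => hψ _⟩

theorem integrable_of_bounded_of_support {X : Type*} [MeasurableSpace X]
    {m : Measure X} {h : X → ℂ} (hh : AEStronglyMeasurable h m) {S : Set X}
    (hSm : m S < ∞) {M : ℝ} (hb : ∀ x, ‖h x‖ ≤ M)
    (h0 : ∀ x, x ∉ S → h x = 0) : Integrable h m := by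
  have : IntegrableOn h S m := Measure.integrableOn_of_bounded hSm.ne hh
    (Filter.Eventually.of_forall hb)
  exact (integrableOn_iff_integrable_of_support_subset fun x hx => by
    by_contra h; exact hx (h0 x h)).1 this

/-- Moving an averaging kernel from one measure to the other costs only a boundary term. -/
theorem exists_norm_sub_convolution_le (θ : Measure G) [θ.IsAddHaarMeasure] {m : Measure G}
    [IsLocallyFiniteMeasure m] (hm : TranslationBounded m) (ψ : C_c(G, ℂ)) {F : G → ℂ}
    (hF : Continuous F) {M : ℝ} (hFM : ∀ x, ‖F x‖ ≤ M) :
    ∃ C : ℝ, 0 ≤ C ∧ ∀ B : Set G, IsCompact B →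
      ‖(∫ t in B, F t * ∫ s, ψ (t - s) ∂m ∂θ) - ∫ s in B, ∫ t, F t * ψ (t - s) ∂θ ∂m‖ ≤
        C * (θ.real (kBoundary (tsupport ψ) B) + θ.real (kBoundary (-tsupport ψ) B)) := by
  obtain ⟨N, hN, hψ⟩ := exists_norm_le ψ
  set K := tsupport ψ
  have hK : IsCompact K := ψ.hasCompactSupport
  have hψ0 : ∀ x, x ∉ K → ψ x = 0 := fun x hx => image_eq_zero_of_notMem_tsupport hx
  obtain ⟨C, hC⟩ := hm _ hK.neg
  have hM : 0 ≤ M := (norm_nonneg _).trans (hFM 0)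
  -- The kernel F(t) ψ(t - s) is bounded by M N, and for fixed t it lives on a set of s of m-measure
  -- at most C.
  refine ⟨M * N * C, by positivity, fun B hB => ?_⟩
  have hBm := hB.isClosed.measurableSet
  let k : G → G → ℂ := fun t s => F t * ψ (t - s)
  have hk : Continuous (Function.uncurry k) := by
    simp only [k, Function.uncurry_def]; fun_prop
  have hkb : ∀ t s, ‖k t s‖ ≤ M * N := fun t s => by
    rw [norm_mul]; exact mul_le_mul (hFM t) (hψ _) (norm_nonneg _) hM
  have hk0 : ∀ t s, t - s ∉ K → k t s = 0 := fun t s h => by simp [k, hψ0 _ h]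
  -- The two double integrals differ only in the variable that is cut off to B: t in `k₁`, s in
  -- `k₂`. Both kernels have bounded support, so Fubini applies to each.
  let k₁ : G → G → ℂ := fun t s => B.indicator (fun t => k t s) t
  let k₂ : G → G → ℂ := fun t s => B.indicator (fun s => k t s) s
  have hk₁m : Measurable (Function.uncurry k₁) := by
    have : Function.uncurry k₁ = ((fun p : G × G => p.1) ⁻¹' B).indicator (Function.uncurry k) := by
      ext ⟨t, s⟩; by_cases h : t ∈ B <;> simp [k₁, h]
    rw [this]; exact hk.measurable.indicator (measurable_fst hBm)
  have hk₂m : Measurable (Function.uncurry k₂) := by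
    have : Function.uncurry k₂ = ((fun p : G × G => p.2) ⁻¹' B).indicator (Function.uncurry k) := by
      ext ⟨t, s⟩; by_cases h : s ∈ B <;> simp [k₂, h]
    rw [this]; exact hk.measurable.indicator (measurable_snd hBm)
  have hind : ∀ t s, ‖k₁ t s‖ ≤ M * N ∧ ‖k₂ t s‖ ≤ M * N ∧ ‖k₁ t s - k₂ t s‖ ≤ M * N := by
    intro t s
    have := hkb t s
    have h0 : 0 ≤ M * N := by positivity
    by_cases h1 : t ∈ B <;> by_cases h2 : s ∈ B <;> simp [k₁, k₂, h1, h2, this, h0]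
  have hint : ∀ S : Set (G × G), IsCompact S → (θ.prod m) S < ∞ := fun S hS => hS.measure_lt_top
  have hi₁ : Integrable (Function.uncurry k₁) (θ.prod m) := by
    refine integrable_of_bounded_of_support hk₁m.aestronglyMeasurable
      (S := B ×ˢ (B - K)) (hint _ (hB.prod (isCompact_sub hB hK)))
      (fun p => (hind p.1 p.2).1) ?_
    rintro ⟨t, s⟩ h
    by_cases h1 : t ∈ B
    · by_cases h2 : t - s ∈ K
      · exact absurd ⟨h1, t, h1, t - s, h2, by simp⟩ h
      · simp [k₁, h1, hk0 t s h2]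
    · simp [k₁, h1]
  have hi₂ : Integrable (Function.uncurry k₂) (θ.prod m) := by
    refine integrable_of_bounded_of_support hk₂m.aestronglyMeasurable
      (S := (B + K) ×ˢ B) (hint _ ((hB.add hK).prod hB))
      (fun p => (hind p.1 p.2).2.1) ?_
    rintro ⟨t, s⟩ h
    by_cases h1 : s ∈ B
    · by_cases h2 : t - s ∈ K
      · exact absurd ⟨⟨s, h1, t - s, h2, by simp⟩, h1⟩ h
      · simp [k₂, h1, hk0 t s h2]
    · simp [k₂, h1]
  have e₁ : ∫ t in B, F t * ∫ s, ψ (t - s) ∂m ∂θ = ∫ t, ∫ s, k₁ t s ∂m ∂θ := by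
    rw [← integral_indicator hBm]
    refine integral_congr_ae (Filter.Eventually.of_forall fun t => ?_)
    by_cases h1 : t ∈ B <;> simp [k₁, k, h1, integral_const_mul]
  have e₂ : ∫ s in B, ∫ t, F t * ψ (t - s) ∂θ ∂m = ∫ t, ∫ s, k₂ t s ∂m ∂θ := by
    rw [integral_integral_swap hi₂, ← integral_indicator hBm]
    refine integral_congr_ae (Filter.Eventually.of_forall fun s => ?_)
    by_cases h1 : s ∈ B <;> simp [k₂, k, h1]
  have hKm : ∀ L, MeasurableSet (kBoundary L B) := fun L => measurableSet_kBoundary hB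
  have hf1 := kBoundary_lt_top hB hK θ
  have hf2 := kBoundary_lt_top hB hK.neg θ
  have e₃ : (∫ t, ∫ s, k₁ t s ∂m ∂θ) - ∫ t, ∫ s, k₂ t s ∂m ∂θ =
      ∫ t, ∫ s, (k₁ t s - k₂ t s) ∂m ∂θ := (integral_integral_sub hi₁ hi₂).symm
  rw [e₁, e₂, e₃]
  set D := kBoundary K B ∪ kBoundary (-K) B
  have hD : MeasurableSet D := (hKm _).union (hKm _)
  have hDfin : θ D < ∞ := (measure_union_le _ _).trans_lt (ENNReal.add_lt_top.2 ⟨hf1, hf2⟩)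
  calc ‖∫ t, ∫ s, (k₁ t s - k₂ t s) ∂m ∂θ‖ ≤ ∫ t, D.indicator (fun _ => M * N * C) t ∂θ := by
        refine norm_integral_le_of_norm_le ?_ (Filter.Eventually.of_forall fun t => ?_)
        · exact (integrable_indicator_iff hD).2 (integrableOn_const hDfin.ne)
        · by_cases ht : t ∈ D
          · rw [Set.indicator_of_mem ht]
            refine TranslationBounded.norm_integral_le hK hC (by positivity) (t := t)
              (fun s hs => ?_) fun s => (hind t s).2.2
            have := hk0 t s hs
            by_cases h1 : t ∈ B <;> by_cases h2 : s ∈ B <;> simp [k₁, k₂, h1, h2, this]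
          · rw [Set.indicator_of_notMem ht]
            -- The difference survives only if t - s ∈ K and exactly one of t, s is in B; either
            -- case puts t into the boundary for K or for -K.
            have : ∀ s, k₁ t s - k₂ t s = 0 := by
              intro s
              by_cases hs : t - s ∈ K
              · by_cases h1 : t ∈ B <;> by_cases h2 : s ∈ B
                · simp [k₁, k₂, h1, h2]
                · exact absurd (Or.inr (mem_kBoundary_of_mem
                    ⟨s, h2, -(t - s), by simpa using hs, by simp⟩ h1)) ht
                · exact absurd (Or.inl (mem_kBoundary_of_notMem
                    ⟨s, h2, t - s, hs, by simp⟩ h1)) ht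
                · simp [k₁, k₂, h1, h2]
              · have := hk0 t s hs
                by_cases h1 : t ∈ B <;> by_cases h2 : s ∈ B <;> simp [k₁, k₂, h1, h2, this]
            simp [this]
    _ = M * N * C * θ.real D := by
        rw [integral_indicator_const _ hD, smul_eq_mul, mul_comm]
    _ ≤ _ := by
        gcongr
        exact measureReal_union_le _ _

end PositiveMeasures

end EberleinConv

namespace EberleinConv

/-! ### Bounded measurable functions and their Haar means. -/

section Means

variable {G : Type*} [AddCommGroup G] [TopologicalSpace G] [IsTopologicalAddGroup G]
    [T2Space G] [LocallyCompactSpace G] [SecondCountableTopology G]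
    [MeasurableSpace G] [BorelSpace G]

/-- Bounded measurable functions. -/
def IsBddMeas {E : Type*} [NormedAddCommGroup E] [MeasurableSpace E] (h : G → E) : Prop :=
  Measurable h ∧ ∃ C : ℝ, ∀ x, ‖h x‖ ≤ C

namespace IsBddMeas

variable {h k : G → ℂ}

theorem integrableOn {E : Type*} [NormedAddCommGroup E] [MeasurableSpace E] [BorelSpace E]
    [SecondCountableTopology E] {h : G → E} (hh : IsBddMeas h) {m : Measure G} {S : Set G}
    (hS : m S < ∞) : IntegrableOn h S m := by
  obtain ⟨h1, C, hC⟩ := hh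
  exact Measure.integrableOn_of_bounded hS.ne h1.aestronglyMeasurable (Eventually.of_forall hC)

theorem add (hh : IsBddMeas h) (hk : IsBddMeas k) : IsBddMeas fun x => h x + k x := by
  obtain ⟨h1, C, hC⟩ := hh
  obtain ⟨k1, D, hD⟩ := hk
  exact ⟨h1.add k1, C + D, fun x => (norm_add_le _ _).trans (add_le_add (hC x) (hD x))⟩

theorem sub (hh : IsBddMeas h) (hk : IsBddMeas k) : IsBddMeas fun x => h x - k x := by
  obtain ⟨h1, C, hC⟩ := hh
  obtain ⟨k1, D, hD⟩ := hk
  exact ⟨h1.sub k1, C + D, fun x => (norm_sub_le _ _).trans (add_le_add (hC x) (hD x))⟩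

theorem mul (hh : IsBddMeas h) (hk : IsBddMeas k) : IsBddMeas fun x => h x * k x := by
  obtain ⟨h1, C, hC⟩ := hh
  obtain ⟨k1, D, hD⟩ := hk
  refine ⟨h1.mul k1, C * D, fun x => ?_⟩
  rw [norm_mul]
  exact mul_le_mul (hC x) (hD x) (norm_nonneg _) ((norm_nonneg _).trans (hC x))

theorem conjugate (hh : IsBddMeas h) : IsBddMeas fun x => conj (h x) :=
  ⟨Complex.continuous_conj.measurable.comp hh.1, by simpa using hh.2⟩

theorem const (c : ℂ) : IsBddMeas fun _ : G => c := ⟨measurable_const, ‖c‖, fun _ => le_rfl⟩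

theorem norm (hh : IsBddMeas h) : IsBddMeas fun x => ‖h x‖ := ⟨hh.1.norm, by simpa using hh.2⟩

theorem norm_sq (hh : IsBddMeas h) : IsBddMeas fun x => ‖h x‖ ^ 2 := by
  simpa [sq] using (hh.mul hh).norm

theorem add_real {h k : G → ℝ} (hh : IsBddMeas h) (hk : IsBddMeas k) :
    IsBddMeas fun x => h x + k x := by
  obtain ⟨h1, C, hC⟩ := hh
  obtain ⟨k1, D, hD⟩ := hk
  exact ⟨h1.add k1, C + D, fun x => (norm_add_le _ _).trans (add_le_add (hC x) (hD x))⟩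

theorem mul_add_const {h : G → ℝ} (hh : IsBddMeas h) (a b : ℝ) :
    IsBddMeas fun x => a * h x + b := by
  obtain ⟨h1, C, hC⟩ := hh
  refine ⟨(h1.const_mul a).add_const b, |a| * C + |b|, fun x => (norm_add_le _ _).trans ?_⟩
  rw [norm_mul, Real.norm_eq_abs, Real.norm_eq_abs b]
  gcongr
  exact hC x

theorem finsetSum {ι : Type*} (s : Finset ι) {h : ι → G → ℂ} (hh : ∀ i ∈ s, IsBddMeas (h i)) :
    IsBddMeas fun x => ∑ i ∈ s, h i x := by
  classical
  induction s using Finset.induction_on with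
  | empty => simpa using const 0
  | insert a s ha ih =>
    simp only [Finset.sum_insert ha]
    exact (hh a (by simp)).add (ih fun i hi => hh i (by simp [hi]))

end IsBddMeas

/-- The mean of a function over the `n`-th averaging set. -/
noncomputable def mean {E : Type*} [NormedAddCommGroup E] [NormedSpace ℝ E]
    (θ : Measure G) (A : ℕ → Set G) (h : G → E) (n : ℕ) : E :=
  (θ.real (A n))⁻¹ • ∫ t in A n, h t ∂θ

variable {θ : Measure G} [θ.IsAddHaarMeasure] {A : ℕ → Set G}

section Basic

variable (hA : IsVanHove θ A)

include hA

theorem mean_add {E : Type*} [NormedAddCommGroup E] [NormedSpace ℝ E] [MeasurableSpace E]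
    [BorelSpace E] [SecondCountableTopology E] {h k : G → E} (hh : IsBddMeas h) (hk : IsBddMeas k) (n : ℕ) :
    mean θ A (fun x => h x + k x) n = mean θ A h n + mean θ A k n := by
  have := (hA.isCompact n).measure_lt_top (μ := θ)
  rw [mean, integral_add (hh.integrableOn this) (hk.integrableOn this), smul_add]; rfl

theorem mean_sub {h k : G → ℂ} (hh : IsBddMeas h) (hk : IsBddMeas k) (n : ℕ) :
    mean θ A (fun x => h x - k x) n = mean θ A h n - mean θ A k n := by
  have := (hA.isCompact n).measure_lt_top (μ := θ)
  rw [mean, integral_sub (hh.integrableOn this) (hk.integrableOn this), smul_sub]; rfl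

theorem mean_finsetSum {ι : Type*} (s : Finset ι) {h : ι → G → ℂ}
    (hh : ∀ i ∈ s, IsBddMeas (h i)) (n : ℕ) :
    mean θ A (fun x => ∑ i ∈ s, h i x) n = ∑ i ∈ s, mean θ A (h i) n := by
  have := (hA.isCompact n).measure_lt_top (μ := θ)
  rw [mean, integral_finsetSum s fun i hi => (hh i hi).integrableOn this, Finset.smul_sum]; rfl

theorem mean_mono {h k : G → ℝ} (hh : IsBddMeas h) (hk : IsBddMeas k) (hle : ∀ x, h x ≤ k x)
    (n : ℕ) : mean θ A h n ≤ mean θ A k n := by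
  have := (hA.isCompact n).measure_lt_top (μ := θ)
  exact smul_le_smul_of_nonneg_left
    (integral_mono (hh.integrableOn this) (hk.integrableOn this) hle) (by positivity)

theorem mean_const {E : Type*} [NormedAddCommGroup E] [NormedSpace ℝ E] [CompleteSpace E]
    (c : E) (n : ℕ) : mean θ A (fun _ => c) n = c := by
  rw [mean, setIntegral_const, smul_smul, inv_mul_cancel₀ (hA.real_pos n).ne', one_smul]

theorem mean_re {h : G → ℂ} (hh : IsBddMeas h) (n : ℕ) :
    mean θ A (fun x => (h x).re) n = (mean θ A h n).re := by
  have := (hA.isCompact n).measure_lt_top (μ := θ)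
  rw [mean, mean, Complex.smul_re]
  congr 1
  exact integral_re (hh.integrableOn this)

end Basic

theorem mean_const_mul (c : ℂ) (h : G → ℂ) (n : ℕ) :
    mean θ A (fun x => c * h x) n = c * mean θ A h n := by
  rw [mean, integral_const_mul, mean, mul_smul_comm]

theorem mean_real_const_mul (c : ℝ) (h : G → ℝ) (n : ℕ) :
    mean θ A (fun x => c * h x) n = c * mean θ A h n := by
  rw [mean, integral_const_mul, mean, mul_smul_comm]

theorem mean_mul_add_const (hA : IsVanHove θ A) {h : G → ℝ} (hh : IsBddMeas h) (a b : ℝ) (n : ℕ) :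
    mean θ A (fun x => a * h x + b) n = a * mean θ A h n + b := by
  have h1 : IsBddMeas fun x => a * h x := by simpa using hh.mul_add_const a 0
  rw [mean_add hA h1 ⟨measurable_const, ‖b‖, fun _ => le_rfl⟩, mean_real_const_mul, mean_const hA]

theorem norm_mean_le (h : G → ℂ) (n : ℕ) : ‖mean θ A h n‖ ≤ mean θ A (fun x => ‖h x‖) n := by
  rw [mean, norm_smul, Real.norm_of_nonneg (by positivity)]
  exact mul_le_mul_of_nonneg_left (norm_integral_le_integral_norm _) (by positivity)

theorem mean_eq_mul (h : G → ℂ) (n : ℕ) :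
    mean θ A h n = (θ.real (A n) : ℂ)⁻¹ * ∫ t in A n, h t ∂θ := by
  rw [mean, Complex.real_smul, Complex.ofReal_inv]

end Means

/-! ### Characters and the algebra of trigonometric polynomials. -/

section Characters

variable {G : Type*} [AddCommGroup G] [TopologicalSpace G]

theorem norm_charFun (χ : Dual G) (t : G) : ‖charFun χ t‖ = 1 := Circle.norm_coe _

theorem charFun_one (t : G) : charFun (1 : Dual G) t = 1 := rfl

theorem charFun_mul (χ ψ : Dual G) (t : G) : charFun (χ * ψ) t = charFun χ t * charFun ψ t := rfl

theorem conj_charFun (χ : Dual G) (t : G) : conj (charFun χ t) = charFun χ⁻¹ t :=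
  (Circle.coe_inv_eq_conj _).symm

theorem charFun_add (χ : Dual G) (s t : G) : charFun χ (s + t) = charFun χ s * charFun χ t := by
  simp [charFun]

theorem continuous_charFun (χ : Dual G) : Continuous (charFun χ) :=
  continuous_subtype_val.comp ((map_continuous χ).comp continuous_ofAdd)

theorem exists_charFun_ne_one {χ : Dual G} (hχ : χ ≠ 1) : ∃ x, charFun χ x ≠ 1 := by
  by_contra! h
  exact hχ (by ext x; exact h x)

/-- Trigonometric polynomials form a star-subalgebra. -/
def trigPolyStarSubalgebra (G : Type*) [AddCommGroup G] [TopologicalSpace G] :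
    StarSubalgebra ℂ (G → ℂ) where
  carrier := {P | IsTrigPoly P}
  add_mem' := fun ha hb => Submodule.add_mem (Submodule.span ℂ (Set.range charFun)) ha hb
  algebraMap_mem' c := by
    have : algebraMap ℂ (G → ℂ) c = c • charFun (1 : Dual G) := by
      ext x; simp [charFun_one]
    rw [this]
    have hmem : charFun (1 : Dual G) ∈ Set.range (charFun (G := G)) := ⟨1, rfl⟩
    exact Submodule.smul_mem _ _ (Submodule.subset_span hmem)
  mul_mem' {a b} ha hb := by
    have := Submodule.mul_mem_mul (M := Submodule.span ℂ (Set.range (charFun (G := G))))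
      (N := Submodule.span ℂ (Set.range (charFun (G := G)))) ha hb
    rw [Submodule.span_mul_span] at this
    have hle : Set.range (charFun (G := G)) * Set.range (charFun (G := G)) ⊆
        Set.range (charFun (G := G)) := by
      rintro _ ⟨_, ⟨χ, rfl⟩, _, ⟨ψ, rfl⟩, rfl⟩
      exact ⟨χ * ψ, rfl⟩
    exact Submodule.span_mono hle this
  star_mem' {a} ha := by
    refine Submodule.span_induction (p := fun x _ => IsTrigPoly (star x)) ?_ ?_ ?_ ?_ ha
    · rintro _ ⟨χ, rfl⟩
      have hmem : star (charFun χ) ∈ Set.range (charFun (G := G)) :=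
        ⟨χ⁻¹, by ext x; exact (conj_charFun χ x).symm⟩
      exact Submodule.subset_span hmem
    · rw [star_zero]; exact Submodule.zero_mem _
    · intro x y _ _ hx hy
      rw [star_add]; exact Submodule.add_mem _ hx hy
    · intro c x _ hx
      rw [star_smul]; exact Submodule.smul_mem _ _ hx

theorem IsTrigPoly.exists_sum {P : G → ℂ} (hP : IsTrigPoly P) :
    ∃ (F : Finset (Dual G)) (a : Dual G → ℂ), P = fun x => ∑ χ ∈ F, a χ * charFun χ x := by
  obtain ⟨c, rfl⟩ := Finsupp.mem_span_range_iff_exists_finsupp.1 hP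
  exact ⟨c.support, c, by ext x; simp [Finsupp.sum]⟩

end Characters

/-! ### Fourier–Bohr coefficients and mean square approximation of Besicovitch functions. -/

section Besicovitch

variable {G : Type*} [AddCommGroup G] [TopologicalSpace G] [IsTopologicalAddGroup G]
    [T2Space G] [LocallyCompactSpace G] [SecondCountableTopology G]
    [MeasurableSpace G] [BorelSpace G]
    {θ : Measure G} [θ.IsAddHaarMeasure] {A : ℕ → Set G}

theorem isBddMeas_charFun (χ : Dual G) : IsBddMeas (charFun χ) :=
  ⟨(continuous_charFun χ).measurable, 1, fun x => (norm_charFun χ x).le⟩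

theorem isBddMeas_sum_charFun (F : Finset (Dual G)) (a : Dual G → ℂ) :
    IsBddMeas fun x => ∑ χ ∈ F, a χ * charFun χ x :=
  IsBddMeas.finsetSum F fun χ _ => (IsBddMeas.const _).mul (isBddMeas_charFun χ)

theorem IsTrigPoly.isBddMeas {P : G → ℂ} (hP : IsTrigPoly P) : IsBddMeas P := by
  obtain ⟨F, a, rfl⟩ := hP.exists_sum
  exact isBddMeas_sum_charFun F a

theorem IsBUC.continuous {f : G → ℂ} (hf : IsBUC f) : Continuous f := by
  rw [continuous_iff_continuousAt]
  intro x
  rw [Metric.continuousAt_iff']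
  intro ε hε
  obtain ⟨U, hU, h⟩ := hf.2 ε hε
  have : Tendsto (fun y => y - x) (𝓝 x) (𝓝 0) := by
    have : Continuous fun y : G => y - x := by fun_prop
    simpa using this.tendsto x
  filter_upwards [this hU] with y hy
  rw [dist_eq_norm]
  exact h y x hy

theorem IsBUC.isBddMeas {f : G → ℂ} (hf : IsBUC f) : IsBddMeas f :=
  ⟨hf.continuous.measurable, hf.1⟩

/-- Non-trivial characters have mean zero along a van Hove sequence. -/
theorem tendsto_mean_charFun (hA : IsVanHove θ A) {χ : Dual G} (hχ : χ ≠ 1) :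
    Tendsto (mean θ A (charFun χ)) atTop (𝓝 0) := by
  obtain ⟨x, hx⟩ := exists_charFun_ne_one hχ
  have hx' : charFun χ x - 1 ≠ 0 := sub_ne_zero.2 hx
  have hc : 0 < ‖charFun χ x - 1‖ := norm_pos_iff.2 hx'
  have hlim : Tendsto (fun n => ‖charFun χ x - 1‖⁻¹ *
      (θ.real (kBoundary {x} (A n)) / θ.real (A n) +
      θ.real (kBoundary {-x} (A n)) / θ.real (A n))) atTop (𝓝 0) := by
    simpa using ((hA.tendsto_boundary {x} isCompact_singleton).add
      (hA.tendsto_boundary {-x} isCompact_singleton)).const_mul ‖charFun χ x - 1‖⁻¹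
  refine squeeze_zero_norm (fun n => ?_) hlim
  have hAn := hA.isCompact n
  have hAm := hAn.isClosed.measurableSet
  have hpos := hA.real_pos n
  have hf1 := kBoundary_lt_top hAn (isCompact_singleton (x := x)) θ
  have hf2 := kBoundary_lt_top hAn (isCompact_singleton (x := -x)) θ
  set D := kBoundary {x} (A n) ∪ kBoundary {-x} (A n)
  have hD : MeasurableSet D := (measurableSet_kBoundary hAn).union (measurableSet_kBoundary hAn)
  have hDfin : θ D < ∞ := (measure_union_le _ _).trans_lt (ENNReal.add_lt_top.2 ⟨hf1, hf2⟩)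
  have hint : Integrable ((A n).indicator (charFun χ)) θ :=
    (integrable_indicator_iff hAm).2 ((isBddMeas_charFun χ).integrableOn hAn.measure_lt_top)
  -- By translation invariance, multiplying the integral by χ(x) amounts to shifting A_n by x. The
  -- two indicators then differ only on the boundaries for {x} and {-x}.
  have key : (charFun χ x - 1) * ∫ t in A n, charFun χ t ∂θ =
      ∫ t, ((A n).indicator (fun _ => charFun χ t) (t - x) -
        (A n).indicator (charFun χ) t) ∂θ := by
    have e : (fun t => (A n).indicator (fun _ => charFun χ t) (t - x)) =
        fun t => charFun χ x * (A n).indicator (charFun χ) (t - x) := by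
      ext t
      by_cases h : t - x ∈ A n
      · simp only [Set.indicator_of_mem h, ← charFun_add, add_sub_cancel]
      · simp [Set.indicator_of_notMem h]
    have e' : (fun t => (A n).indicator (fun _ => charFun χ t) (t - x) -
        (A n).indicator (charFun χ) t) = fun t => charFun χ x *
          (A n).indicator (charFun χ) (t - x) - (A n).indicator (charFun χ) t := by
      ext t; rw [congrFun e t]
    rw [e', integral_sub ((hint.comp_sub_right x).const_mul _) hint, integral_const_mul,
      integral_sub_right_eq_self, integral_indicator hAm]
    ring
  have hle : ‖(charFun χ x - 1) * ∫ t in A n, charFun χ t ∂θ‖ ≤ θ.real D := by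
    rw [key]
    calc _ ≤ ∫ t, D.indicator (fun _ => (1 : ℝ)) t ∂θ := by
          refine norm_integral_le_of_norm_le
            ((integrable_indicator_iff hD).2 (integrableOn_const hDfin.ne))
            (Eventually.of_forall fun t => ?_)
          by_cases h1 : t - x ∈ A n <;> by_cases h2 : t ∈ A n
          · simpa [h1, h2] using Set.indicator_nonneg (fun _ _ => zero_le_one) _
          · have : t ∈ D := Or.inl (mem_kBoundary_of_notMem ⟨t - x, h1, x, rfl, by simp⟩ h2)
            simp [h1, h2, this, norm_charFun]
          · have : t ∈ D := Or.inr (mem_kBoundary_of_mem ⟨t - x, h1, -x, rfl, by simp⟩ h2)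
            simp [h1, h2, this, norm_charFun]
          · simpa [h1, h2] using Set.indicator_nonneg (fun _ _ => zero_le_one) _
      _ = θ.real D := by rw [integral_indicator_const _ hD]; simp
  rw [norm_mul, ← le_div_iff₀' hc] at hle
  rw [mean, norm_smul, norm_inv, Real.norm_of_nonneg hpos.le]
  calc _ ≤ (θ.real (A n))⁻¹ * (θ.real D / ‖charFun χ x - 1‖) := by gcongr
    _ ≤ (θ.real (A n))⁻¹ * ((θ.real (kBoundary {x} (A n)) + θ.real (kBoundary {-x} (A n)))
          / ‖charFun χ x - 1‖) := by gcongr; exact measureReal_union_le _ _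
    _ = _ := by ring

/-- Asymptotic orthonormality: the product is the character χψ⁻¹, which is trivial exactly when χ =
ψ. -/
theorem tendsto_mean_charFun_mul_conj [DecidableEq (Dual G)] (hA : IsVanHove θ A) (χ ψ : Dual G) :
    Tendsto (mean θ A fun x => charFun χ x * conj (charFun ψ x)) atTop
      (𝓝 (if χ = ψ then 1 else 0)) := by
  have e : (fun x => charFun χ x * conj (charFun ψ x)) = charFun (χ * ψ⁻¹) := by
    ext x; rw [conj_charFun, charFun_mul]
  rw [e]
  split_ifs with h
  · subst h
    have : mean θ A (charFun (χ * χ⁻¹)) = fun _ => 1 := by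
      ext n
      rw [mul_inv_cancel]
      exact mean_const hA (1 : ℂ) n
    rw [this]
    exact tendsto_const_nhds
  · exact tendsto_mean_charFun hA (by rwa [ne_eq, mul_inv_eq_one])

theorem tendsto_mean_sum_mul_conj [DecidableEq (Dual G)] (hA : IsVanHove θ A)
    (F : Finset (Dual G)) (a : Dual G → ℂ) (ψ : Dual G) :
    Tendsto (mean θ A fun x => (∑ χ ∈ F, a χ * charFun χ x) * conj (charFun ψ x)) atTop
      (𝓝 (if ψ ∈ F then a ψ else 0)) := by
  have e : (mean θ A fun x => (∑ χ ∈ F, a χ * charFun χ x) * conj (charFun ψ x)) =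
      fun n => ∑ χ ∈ F, a χ * mean θ A (fun x => charFun χ x * conj (charFun ψ x)) n := by
    ext n
    simp only [Finset.sum_mul, mul_assoc]
    rw [mean_finsetSum hA F fun χ _ => (IsBddMeas.const _).mul
      ((isBddMeas_charFun χ).mul (isBddMeas_charFun ψ).conjugate)]
    simp only [mean_const_mul]
  rw [e]
  have := tendsto_finsetSum F fun χ _ =>
    (tendsto_mean_charFun_mul_conj hA χ ψ).const_mul (a χ)
  simpa using this

theorem eventually_mean_norm_lt (hA : IsVanHove θ A) {h : G → ℂ} (hh : IsBddMeas h) {ε : ℝ}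
    (hε : besicovitchSeminorm θ A h < ε) : ∀ᶠ n in atTop, mean θ A (fun x => ‖h x‖) n < ε := by
  obtain ⟨C, hC⟩ := hh.2
  refine eventually_lt_of_limsup_lt hε ?_
  -- A real `limsup` carries information only for bounded sequences; this is where boundedness of h
  -- enters.
  refine isBoundedUnder_of ⟨C, fun n => ?_⟩
  have h1 := mean_mono hA hh.norm ⟨measurable_const, ‖C‖, fun _ => le_rfl⟩ hC n
  rwa [mean_const hA] at h1

/-- A Besicovitch almost periodic function has all its Fourier–Bohr coefficients. -/
theorem IsBesicovitchFun.exists_coeff (hA : IsVanHove θ A) {f : G → ℂ}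
    (hf : IsBesicovitchFun θ A f) (ψ : Dual G) :
    ∃ c, Tendsto (mean θ A fun x => f x * conj (charFun ψ x)) atTop (𝓝 c) := by
  classical
  refine cauchySeq_tendsto_of_complete (Metric.cauchySeq_iff'.2 fun ε hε => ?_)
  obtain ⟨P, hP, hfP⟩ := hf.2 (ε / 4) (by positivity)
  have hfm := hf.1.isBddMeas
  have h1 := eventually_mean_norm_lt hA (hfm.sub hP.isBddMeas) hfP
  -- Since |ψ| = 1, the averages for f stay within ε/4 of those for P, which converge; so they form
  -- a Cauchy sequence.
  have hd : ∀ n, ‖mean θ A (fun x => f x * conj (charFun ψ x)) n -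
      mean θ A (fun x => P x * conj (charFun ψ x)) n‖ ≤ mean θ A (fun x => ‖f x - P x‖) n := by
    intro n
    rw [← mean_sub hA (hfm.mul (isBddMeas_charFun ψ).conjugate)
      (hP.isBddMeas.mul (isBddMeas_charFun ψ).conjugate)]
    refine (norm_mean_le _ _).trans (le_of_eq ?_)
    congr 1
    ext x
    rw [← sub_mul, norm_mul, RCLike.norm_conj, norm_charFun, mul_one]
  obtain ⟨F, a, rfl⟩ := hP.exists_sum
  have h2 := (Metric.tendsto_nhds.1 (tendsto_mean_sum_mul_conj hA F a ψ)) (ε / 4) (by positivity)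
  obtain ⟨N, hN⟩ := eventually_atTop.1 (h1.and h2)
  refine ⟨N, fun n hn => ?_⟩
  have a1 := (hd n).trans_lt (hN n hn).1
  have a2 := (hd N).trans_lt (hN N le_rfl).1
  rw [← dist_eq_norm] at a1 a2
  have a3 := (hN n hn).2
  have a4 := (hN N le_rfl).2
  rw [dist_comm] at a2 a4
  have b1 := dist_triangle4 (mean θ A (fun x => f x * conj (charFun ψ x)) n)
    (mean θ A (fun x => (∑ χ ∈ F, a χ * charFun χ x) * conj (charFun ψ x)) n)
    (mean θ A (fun x => (∑ χ ∈ F, a χ * charFun χ x) * conj (charFun ψ x)) N)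
    (mean θ A (fun x => f x * conj (charFun ψ x)) N)
  have b2 := dist_triangle (mean θ A (fun x => (∑ χ ∈ F, a χ * charFun χ x) *
      conj (charFun ψ x)) n) (if ψ ∈ F then a ψ else 0)
    (mean θ A (fun x => (∑ χ ∈ F, a χ * charFun χ x) * conj (charFun ψ x)) N)
  linarith

/-- Truncation of the real and imaginary parts to `[-M, M]`. -/
noncomputable def clamp (M : ℝ) (z : ℂ) : ℂ := ⟨max (-M) (min M z.re), max (-M) (min M z.im)⟩

theorem continuous_clamp (M : ℝ) : Continuous (clamp M) := by
  have : clamp M = fun z : ℂ => ((max (-M) (min M z.re) : ℝ) : ℂ) +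
      ((max (-M) (min M z.im) : ℝ) : ℂ) * Complex.I := by
    ext z; apply Complex.ext <;> simp [clamp]
  rw [this]
  fun_prop

/-- Converts L¹ closeness into L² closeness. Truncation fixes the coordinates of w and does not
increase distances, so each coordinate of the difference is bounded both by ‖w - z‖ and by 2M;
multiply the two bounds. The constant 8 is not sharp. -/
theorem norm_sub_clamp_sq_le {M : ℝ} {w z : ℂ} (hw : ‖w‖ ≤ M) :
    ‖w - clamp M z‖ ^ 2 ≤ 8 * M * ‖w - z‖ := by
  have hr := (Complex.abs_re_le_norm w).trans hw
  have hi := (Complex.abs_im_le_norm w).trans hw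
  have hM : 0 ≤ M := (norm_nonneg _).trans hw
  have key : ∀ a b : ℝ, |a| ≤ M → |a - max (-M) (min M b)| ≤ |a - b| ∧
      |a - max (-M) (min M b)| ≤ 2 * M := by
    intro a b ha
    obtain ⟨h1, h2⟩ := abs_le.1 ha
    constructor
    · rcases le_total M b with h | h
      · rw [min_eq_left h, max_eq_right (by linarith), abs_of_nonpos (by linarith),
          abs_of_nonpos (by linarith)]
        linarith
      · rw [min_eq_right h]
        rcases le_total (-M) b with h' | h'
        · rw [max_eq_right h']
        · rw [max_eq_left h', abs_of_nonneg (by linarith), abs_of_nonneg (by linarith)]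
          linarith
    · have h3 : -M ≤ max (-M) (min M b) := le_max_left _ _
      have h4 : max (-M) (min M b) ≤ M := max_le (by linarith) (min_le_left _ _)
      rw [abs_le]; constructor <;> linarith
  obtain ⟨r1, r2⟩ := key w.re z.re hr
  obtain ⟨i1, i2⟩ := key w.im z.im hi
  have h1 := Complex.abs_re_le_norm (w - z)
  have h2 := Complex.abs_im_le_norm (w - z)
  rw [Complex.sub_re] at h1
  rw [Complex.sub_im] at h2
  rw [Complex.sq_norm, Complex.normSq_apply]
  simp only [Complex.sub_re, Complex.sub_im, clamp]
  rw [← abs_mul_abs_self (w.re - _), ← abs_mul_abs_self (w.im - _)]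
  have n := norm_nonneg (w - z)
  have e1 := mul_le_mul r2 (r1.trans h1) (abs_nonneg _) (by positivity)
  have e2 := mul_le_mul i2 (i1.trans h2) (abs_nonneg _) (by positivity)
  nlinarith [mul_nonneg hM n]

/-- Continuous functions of trigonometric polynomials are uniform limits of trigonometric
polynomials. -/
theorem IsTrigPoly.exists_approx_comp {P : G → ℂ} (hP : IsTrigPoly P) {T : ℂ → ℂ}
    (hT : Continuous T) {η : ℝ} (hη : 0 < η) :
    ∃ Q : G → ℂ, IsTrigPoly Q ∧ ∀ x, ‖T (P x) - Q x‖ ≤ η := by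
  obtain ⟨-, r, hr⟩ := hP.isBddMeas
  let s : Set ℂ := Metric.closedBall 0 r
  have hPs : ∀ x, P x ∈ s := fun x => by simpa [s] using hr x
  have : CompactSpace s := isCompact_iff_compactSpace.1 (isCompact_closedBall 0 r)
  let T' : C(s, ℂ) := ⟨fun z => T z, by fun_prop⟩
  -- Complex Stone–Weierstrass on a disc containing the values of P; polynomials in z and its
  -- conjugate are required.
  have hT' : T' ∈ (polynomialFunctions s).starClosure.topologicalClosure := by
    rw [polynomialFunctions.starClosure_topologicalClosure]; trivial
  obtain ⟨p, hp, hpd⟩ := Metric.mem_closure_iff.1 hT' η hη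
  -- Composition with P is a star homomorphism sending the coordinate function to P, so it maps
  -- star-polynomials to trigonometric polynomials.
  let Φ : C(s, ℂ) →⋆ₐ[ℂ] (G → ℂ) :=
    { toFun := fun h x => h ⟨P x, hPs x⟩
      map_one' := rfl
      map_mul' := fun _ _ => rfl
      map_zero' := rfl
      map_add' := fun _ _ => rfl
      commutes' := fun _ => rfl
      map_star' := fun _ => rfl }
  refine ⟨Φ p, ?_, fun x => ?_⟩
  · change Φ p ∈ trigPolyStarSubalgebra G
    have hle : (polynomialFunctions s).starClosure ≤ (trigPolyStarSubalgebra G).comap Φ := by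
      rw [polynomialFunctions.starClosure_eq_adjoin_X]
      refine StarAlgebra.adjoin_le ?_
      rintro _ rfl
      have : Φ (Polynomial.toContinuousMapOnAlgHom s Polynomial.X) = P := by
        ext x
        change (Polynomial.X : Polynomial ℂ).eval (P x) = P x
        simp
      change Φ _ ∈ trigPolyStarSubalgebra G
      rw [this]
      exact hP
    exact hle hp
  · have := (ContinuousMap.dist_lt_iff hη).1 hpd ⟨P x, hPs x⟩
    rw [dist_eq_norm] at this
    exact this.le

/-- The L¹ approximant may be much larger than f, which spoils its mean square distance; truncating
it at a bound of f cures this, and the truncation is then uniformly approximated by Q. -/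
theorem IsBesicovitchFun.exists_sq_approx (hA : IsVanHove θ A) {f : G → ℂ}
    (hf : IsBesicovitchFun θ A f) {ε : ℝ} (hε : 0 < ε) :
    ∃ Q : G → ℂ, IsTrigPoly Q ∧ ∀ᶠ n in atTop, mean θ A (fun x => ‖f x - Q x‖ ^ 2) n < ε := by
  obtain ⟨M, hM⟩ := hf.1.1
  have hM0 : 0 ≤ M := (norm_nonneg _).trans (hM 0)
  -- Chosen so that the term 16 M ‖f - P‖ below contributes at most ε/2; the 1 covers M = 0.
  obtain ⟨P, hP, hfP⟩ := hf.2 (ε / (32 * M + 1)) (by positivity)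
  obtain ⟨Q, hQ, hPQ⟩ := hP.exists_approx_comp (continuous_clamp M)
    -- With this choice η² ≤ η ≤ ε/8.
    (η := min 1 (ε / 8)) (by positivity)
  refine ⟨Q, hQ, ?_⟩
  have hfm := hf.1.isBddMeas
  filter_upwards [eventually_mean_norm_lt hA (hfm.sub hP.isBddMeas) hfP] with n hn
  have hpt : ∀ x, ‖f x - Q x‖ ^ 2 ≤ 16 * M * ‖f x - P x‖ + ε / 4 := by
    intro x
    have h1 := norm_sub_clamp_sq_le (z := P x) (hM x)
    have h2 := hPQ x
    have h3 : ‖clamp M (P x) - Q x‖ ^ 2 ≤ ε / 8 := by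
      have a1 := h2.trans (min_le_left _ _)
      have a2 := h2.trans (min_le_right _ _)
      nlinarith [norm_nonneg (clamp M (P x) - Q x)]
    have h4 : ‖f x - Q x‖ ≤ ‖f x - clamp M (P x)‖ + ‖clamp M (P x) - Q x‖ :=
      norm_sub_le_norm_sub_add_norm_sub _ _ _
    have h5 := pow_le_pow_left₀ (norm_nonneg _) h4 2
    nlinarith [sq_nonneg (‖f x - clamp M (P x)‖ - ‖clamp M (P x) - Q x‖)]
  have hbm := (hfm.sub hP.isBddMeas).norm.mul_add_const (16 * M) (ε / 4)
  have h6 := mean_mono hA (hfm.sub hQ.isBddMeas).norm_sq hbm hpt n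
  have h7 : mean θ A (fun x => 16 * M * ‖f x - P x‖ + ε / 4) n =
      16 * M * mean θ A (fun x => ‖f x - P x‖) n + ε / 4 :=
    mean_mul_add_const hA (hfm.sub hP.isBddMeas).norm _ _ n
  have h8 : 16 * M * mean θ A (fun x => ‖f x - P x‖) n ≤ ε / 2 := by
    calc _ ≤ 16 * M * (ε / (32 * M + 1)) := by gcongr
      _ ≤ _ := by
        rw [mul_div_assoc', div_le_div_iff₀ (by positivity) (by positivity)]
        nlinarith
  rw [h7] at h6
  linarith

/-- A bounded function whose Fourier–Bohr coefficients vanish on the spectrum of a Besicovitch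
almost periodic function is orthogonal to that function in the mean. -/
theorem IsBesicovitchFun.tendsto_mean_conj_mul (hA : IsVanHove θ A) {f g : G → ℂ}
    (hf : IsBesicovitchFun θ A f) (hg : IsBddMeas g)
    (hfg : ∀ (χ : Dual G) (c : ℂ), c ≠ 0 →
      Tendsto (mean θ A fun x => f x * conj (charFun χ x)) atTop (𝓝 c) →
      Tendsto (mean θ A fun x => conj (charFun χ x) * g x) atTop (𝓝 0)) :
    Tendsto (mean θ A fun x => conj (f x) * g x) atTop (𝓝 0) := by
  classical
  choose c hc using hf.exists_coeff hA
  have hfm := hf.1.isBddMeas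
  obtain ⟨L, hL⟩ := hg.2
  have hL0 : 0 ≤ L := (norm_nonneg _).trans (hL 0)
  rw [Metric.tendsto_nhds]
  intro ε hε
  -- Makes L δ at most ε/2; δ is the intended mean square scale of the approximation.
  set δ := ε / (2 * (L + 1)) with hδ
  have hδ0 : 0 < δ := by positivity
  obtain ⟨Q, hQ, hfQ⟩ := hf.exists_sq_approx hA (ε := δ ^ 2) (by positivity)
  obtain ⟨F, a, rfl⟩ := hQ.exists_sum
  -- The asymptotic orthogonal projection of f onto the frequencies of Q.
  set R : G → ℂ := fun x => ∑ χ ∈ F, c χ * charFun χ x with hR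
  have hRm : IsBddMeas R := isBddMeas_sum_charFun F c
  have hQm := isBddMeas_sum_charFun (G := G) F a
  have hDm := isBddMeas_sum_charFun (G := G) F fun χ => a χ - c χ
  have hfRm := hfm.sub hRm
  -- the difference of `f` and `R` is asymptotically orthogonal to the frequencies of `R`
  have horth : ∀ χ ∈ F,
      Tendsto (mean θ A fun x => (f x - R x) * conj (charFun χ x)) atTop (𝓝 0) := by
    intro χ hχ
    have h1 := tendsto_mean_sum_mul_conj hA F c χ
    rw [if_pos hχ] at h1
    have h2 := (hc χ).sub h1
    rw [sub_self] at h2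
    refine h2.congr fun n => ?_
    rw [← mean_sub hA (hfm.mul (isBddMeas_charFun χ).conjugate) (hRm.mul (isBddMeas_charFun χ).conjugate)]
    simp only [sub_mul, hR]
  have hD : Tendsto (mean θ A fun x => (f x - R x) *
      conj (∑ χ ∈ F, (a χ - c χ) * charFun χ x)) atTop (𝓝 0) := by
    have e : (mean θ A fun x => (f x - R x) * conj (∑ χ ∈ F, (a χ - c χ) * charFun χ x)) =
        fun n => ∑ χ ∈ F, conj (a χ - c χ) *
          mean θ A (fun x => (f x - R x) * conj (charFun χ x)) n := by
      ext n
      simp only [← mean_const_mul]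
      rw [← mean_finsetSum hA F fun χ _ => (IsBddMeas.const _).mul
        (hfRm.mul (isBddMeas_charFun χ).conjugate)]
      congr 1
      ext x
      rw [map_sum, Finset.mul_sum]
      refine Finset.sum_congr rfl fun χ _ => ?_
      rw [map_mul]; ring
    rw [e]
    simpa using tendsto_finsetSum F fun χ hχ => (horth χ hχ).const_mul (conj (a χ - c χ))
  have hRg : Tendsto (mean θ A fun x => conj (R x) * g x) atTop (𝓝 0) := by
    have e : (mean θ A fun x => conj (R x) * g x) =
        fun n => ∑ χ ∈ F, conj (c χ) * mean θ A (fun x => conj (charFun χ x) * g x) n := by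
      ext n
      simp only [← mean_const_mul]
      rw [← mean_finsetSum hA F fun χ _ => (IsBddMeas.const _).mul
        ((isBddMeas_charFun χ).conjugate.mul hg)]
      congr 1
      ext x
      simp only [hR]
      rw [map_sum, Finset.sum_mul]
      refine Finset.sum_congr rfl fun χ _ => ?_
      rw [map_mul]; ring
    rw [e, ← Finset.sum_const_zero (s := F)]
    refine tendsto_finsetSum F fun χ _ => ?_
    -- Frequencies outside the spectrum of f drop out of R, so g may lack Fourier–Bohr coefficients
    -- there.
    by_cases h0 : c χ = 0
    · simp only [h0, map_zero, zero_mul]; exact tendsto_const_nhds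
    · simpa using (hfg χ (c χ) h0 (hc χ)).const_mul (conj (c χ))
  have hDre : Tendsto (fun n => 2 * (mean θ A (fun x => (f x - R x) *
      conj (∑ χ ∈ F, (a χ - c χ) * charFun χ x)) n).re) atTop (𝓝 0) := by
    have := ((Complex.continuous_re.tendsto 0).comp hD).const_mul 2
    rw [Complex.zero_re, mul_zero] at this
    exact this
  filter_upwards [hfQ, hDre.eventually_lt_const (show (0 : ℝ) < δ ^ 2 by positivity),
    (Metric.tendsto_nhds.1 hRg) (ε / 4) (by positivity)] with n h1 h2 h3
  rw [dist_zero_right] at h3 ⊢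
  have hprod := hfRm.mul hDm.conjugate
  have hre : IsBddMeas fun x => ((f x - R x) * conj (∑ χ ∈ F, (a χ - c χ) * charFun χ x)).re :=
    ⟨Complex.measurable_re.comp hprod.1, hprod.2.imp fun C hC x =>
      (Complex.abs_re_le_norm _).trans (hC x)⟩
  have hre2 : IsBddMeas fun x =>
      2 * ((f x - R x) * conj (∑ χ ∈ F, (a χ - c χ) * charFun χ x)).re := by
    simpa using hre.mul_add_const 2 0
  -- Pythagoras for f - Q = (f - R) - (Q - R): the cross term has mean tending to zero, so it costs
  -- less than another δ² for this n.
  have hsq : mean θ A (fun x => ‖f x - R x‖ ^ 2) n < 2 * δ ^ 2 := by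
    have hle : ∀ x, ‖f x - R x‖ ^ 2 ≤ ‖f x - ∑ χ ∈ F, a χ * charFun χ x‖ ^ 2 +
        2 * ((f x - R x) * conj (∑ χ ∈ F, (a χ - c χ) * charFun χ x)).re := by
      intro x
      have e : f x - ∑ χ ∈ F, a χ * charFun χ x =
          (f x - R x) - ∑ χ ∈ F, (a χ - c χ) * charFun χ x := by
        simp only [hR, sub_mul, Finset.sum_sub_distrib]; ring
      rw [e]
      generalize f x - R x = u
      generalize ∑ χ ∈ F, (a χ - c χ) * charFun χ x = v
      rw [Complex.sq_norm, Complex.sq_norm, Complex.normSq_sub]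
      linarith [Complex.normSq_nonneg v]
    have hbd : IsBddMeas fun x => ‖f x - ∑ χ ∈ F, a χ * charFun χ x‖ ^ 2 +
        2 * ((f x - R x) * conj (∑ χ ∈ F, (a χ - c χ) * charFun χ x)).re :=
      (hfm.sub hQm).norm_sq.add_real hre2
    have h4 := mean_mono hA hfRm.norm_sq hbd hle n
    rw [mean_add hA (hfm.sub hQm).norm_sq hre2, mean_real_const_mul, mean_re hA hprod] at h4
    linarith
  have hsplit : mean θ A (fun x => conj (f x) * g x) n =
      mean θ A (fun x => conj (f x) * g x - conj (R x) * g x) n +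
        mean θ A (fun x => conj (R x) * g x) n := by
    rw [mean_sub hA (hfm.conjugate.mul hg) (hRm.conjugate.mul hg), sub_add_cancel]
  have hdiff : ‖mean θ A (fun x => conj (f x) * g x - conj (R x) * g x) n‖ ≤
      L / (2 * δ) * (2 * δ ^ 2) + L * δ / 2 := by
    have hle : ∀ x, ‖conj (f x) * g x - conj (R x) * g x‖ ≤
        L / (2 * δ) * ‖f x - R x‖ ^ 2 + L * δ / 2 := by
      intro x
      rw [← sub_mul, ← map_sub, norm_mul, RCLike.norm_conj]
      -- A pointwise arithmetic–geometric mean inequality takes the place of Cauchy–Schwarz for the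
      -- means.
      have h5 : ‖f x - R x‖ ≤ ‖f x - R x‖ ^ 2 / (2 * δ) + δ / 2 := by
        rw [div_add_div _ _ (by positivity) (by norm_num), le_div_iff₀ (by positivity)]
        nlinarith [sq_nonneg (‖f x - R x‖ - δ)]
      calc ‖f x - R x‖ * ‖g x‖ ≤ (‖f x - R x‖ ^ 2 / (2 * δ) + δ / 2) * L := by
            gcongr; exact hL x
        _ = _ := by ring
    refine (norm_mean_le _ _).trans ?_
    refine (mean_mono hA ((hfm.conjugate.mul hg).sub (hRm.conjugate.mul hg)).norm
      (hfRm.norm_sq.mul_add_const _ _) hle n).trans ?_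
    rw [mean_mul_add_const hA hfRm.norm_sq]
    gcongr
  have hbound : L / (2 * δ) * (2 * δ ^ 2) + L * δ / 2 ≤ 3 * ε / 4 := by
    have e1 : L / (2 * δ) * (2 * δ ^ 2) + L * δ / 2 = 3 / 2 * (L * δ) := by
      field_simp; ring
    have e2 : L * δ ≤ ε / 2 := by
      rw [hδ, mul_div_assoc', div_le_div_iff₀ (by positivity) (by positivity)]
      nlinarith
    rw [e1]; linarith
  rw [hsplit]
  refine (norm_add_le _ _).trans_lt ?_
  linarith

end Besicovitch

end EberleinConv

namespace EberleinConv

namespace RadonMeasure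

/-! ### Decomposition of a Radon measure into positive parts, all translation bounded. -/

section Parts

variable {G : Type*} [AddCommGroup G] [TopologicalSpace G] [IsTopologicalAddGroup G]
    [T2Space G] [LocallyCompactSpace G] [SecondCountableTopology G]
    [MeasurableSpace G] [BorelSpace G]

/-- The positive measures of which a Radon measure is a linear combination. -/
noncomputable def part (ν : RadonMeasure G) : Fin 3 → Measure G :=
  ![ν.rePlus, ν.imPlus, ν.variation]

/-- The coefficients of the linear combination. -/
noncomputable def partCoeff : Fin 3 → ℂ := ![1, Complex.I, -(1 + Complex.I)]

theorem setIntegral_eq_sum (ν : RadonMeasure G) (S : Set G) (f : G → ℂ) :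
    ν.setIntegral S f = ∑ i, partCoeff i * ∫ x in S, f x ∂ν.part i := by
  simp [setIntegral, Fin.sum_univ_three, part, partCoeff]
  ring

theorem integral_eq_sum (ν : RadonMeasure G) (f : G → ℂ) :
    ν.integral f = ∑ i, partCoeff i * ∫ x, f x ∂ν.part i := by
  simp [integral, setIntegral_eq_sum]

instance (ν : RadonMeasure G) (i : Fin 3) : (ν.part i).Regular := by
  fin_cases i
  · exact inferInstanceAs ν.rePlus.Regular
  · exact inferInstanceAs ν.imPlus.Regular
  · exact inferInstanceAs ν.variation.Regular

theorem shiftedFunctional_le (ν : RadonMeasure G) (w : ℂ) (hw : ‖w‖ = 1) (φ : C_c(G, ℝ≥0)) :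
    ν.shiftedFunctional w hw φ ≤ 2 * ν.variationFunctional φ := by
  rw [← NNReal.coe_le_coe, NNReal.coe_mul, coe_shiftedFunctional, coe_variationFunctional]
  have h1 : ‖ν (toComplex φ)‖ ≤ ν.variationValue φ := ν.le_variationValue fun x => by simp
  have h2 := Complex.re_le_norm (w * ν (toComplex φ))
  rw [norm_mul, hw, one_mul] at h2
  push_cast
  linarith

/-- Insert a Urysohn function between the indicators of K and U. The loss from K to U is harmless
for translation boundedness, where K may be enlarged to a compact neighbourhood. -/
theorem rieszMeasure_le_two_mul {Λ₁ Λ₂ : C_c(G, ℝ≥0) →ₗ[ℝ≥0] ℝ≥0}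
    (h : ∀ φ, Λ₁ φ ≤ 2 * Λ₂ φ) {K U : Set G} (hK : IsCompact K) (hU : IsOpen U) (hKU : K ⊆ U) :
    NNRealRMK.rieszMeasure Λ₁ K ≤ 2 * NNRealRMK.rieszMeasure Λ₂ U := by
  obtain ⟨f, hf1, hf2, hf3, hf4⟩ := exists_continuousMap_one_of_isCompact_subset_isOpen hK hU hKU
  let φ : C_c(G, ℝ≥0) := ⟨⟨fun x => (f x).toNNReal, by fun_prop⟩,
    HasCompactSupport.comp_left (g := Real.toNNReal) (hasCompactSupport_def.mpr hf2) (by simp)⟩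
  have hφ : ∀ x, φ x = (f x).toNNReal := fun x => rfl
  calc NNRealRMK.rieszMeasure Λ₁ K
      = ∫⁻ x, K.indicator 1 x ∂NNRealRMK.rieszMeasure Λ₁ :=
        (lintegral_indicator_one hK.isClosed.measurableSet).symm
    _ ≤ ∫⁻ x, φ x ∂NNRealRMK.rieszMeasure Λ₁ := by
        refine lintegral_mono fun x => ?_
        by_cases hx : x ∈ K
        · have : f x = 1 := hf1 hx
          simp [hx, hφ, this]
        · simp [hx]
    _ = Λ₁ φ := NNRealRMK.lintegral_rieszMeasure Λ₁ φ
    _ ≤ 2 * Λ₂ φ := by exact_mod_cast h φ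
    _ = 2 * ∫⁻ x, φ x ∂NNRealRMK.rieszMeasure Λ₂ := by rw [NNRealRMK.lintegral_rieszMeasure Λ₂ φ]
    _ ≤ 2 * ∫⁻ x, U.indicator 1 x ∂NNRealRMK.rieszMeasure Λ₂ := by
        gcongr with x
        by_cases hx : x ∈ U
        · simp only [hx, Set.indicator_of_mem, Pi.one_apply, hφ]
          have := Real.toNNReal_le_one.2 (hf4 x).2
          exact_mod_cast this
        · have : f x = 0 := image_eq_zero_of_notMem_tsupport fun h => hx (hf3 h)
          simp [hφ, this]
    _ = 2 * NNRealRMK.rieszMeasure Λ₂ U := by rw [lintegral_indicator_one hU.measurableSet]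

theorem IsTranslationBounded.variation {ν : RadonMeasure G} (hν : ν.IsTranslationBounded) :
    TranslationBounded ν.variation := by
  intro K hK
  refine ⟨(⨆ t : G, ν.variation ((fun x => t + x) '' K)).toNNReal, fun t => ?_⟩
  rw [ENNReal.coe_toNNReal (hν K hK).ne]
  exact le_iSup (fun t : G => ν.variation ((fun x => t + x) '' K)) t

theorem IsTranslationBounded.shifted {ν : RadonMeasure G} (hν : ν.IsTranslationBounded) (w : ℂ)
    (hw : ‖w‖ = 1) : TranslationBounded (NNRealRMK.rieszMeasure (ν.shiftedFunctional w hw)) := by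
  intro K hK
  obtain ⟨L, hL, hKL⟩ := exists_compact_superset hK
  obtain ⟨C, hC⟩ := hν.variation L hL
  refine ⟨2 * C, fun t => ?_⟩
  have hopen : IsOpen ((fun x => t + x) '' interior L) :=
    (Homeomorph.addLeft t).isOpenMap _ isOpen_interior
  refine (rieszMeasure_le_two_mul (ν.shiftedFunctional_le w hw) (isCompact_image_add hK t) hopen
    (Set.image_mono hKL)).trans ?_
  rw [ENNReal.coe_mul]
  exact mul_le_mul_right ((measure_mono (Set.image_mono interior_subset)).trans (hC t)) _

theorem IsTranslationBounded.part {ν : RadonMeasure G} (hν : ν.IsTranslationBounded) (i : Fin 3) :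
    TranslationBounded (ν.part i) := by
  fin_cases i
  · exact hν.shifted _ _
  · exact hν.shifted _ _
  · exact hν.variation

end Parts

/-! ### Positive parts of the tilde of a measure. -/

section Tilde

variable {G : Type*} [AddCommGroup G] [TopologicalSpace G] [IsTopologicalAddGroup G]

/-- The reflection `x ↦ φ (-x)` of a test function. -/
def reflect {R : Type*} [TopologicalSpace R] [Zero R] (φ : C_c(G, R)) : C_c(G, R) where
  toFun x := φ (-x)
  continuous_toFun := by fun_prop
  hasCompactSupport' := φ.hasCompactSupport.comp_homeomorph (Homeomorph.neg G)

@[simp] theorem reflect_apply {R : Type*} [TopologicalSpace R] [Zero R] (φ : C_c(G, R)) (x : G) :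
    reflect φ x = φ (-x) := rfl

theorem tilde_apply (ν : RadonMeasure G) (φ : C_c(G, ℂ)) :
    ν.tilde φ = conj (ν (tildeFun φ)) := rfl

theorem tildeFun_tildeFun (φ : C_c(G, ℂ)) : tildeFun (tildeFun φ) = φ := by ext x; simp

theorem tilde_toComplex (ν : RadonMeasure G) (φ : C_c(G, ℝ≥0)) :
    ν.tilde (toComplex φ) = conj (ν (toComplex (reflect φ))) := by
  rw [tilde_apply]
  congr 2
  ext x; simp

/-- The tilde is an involution on test functions that exchanges those dominated by φ with those
dominated by its reflection, and conjugation preserves absolute values. -/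
theorem variationValue_tilde (ν : RadonMeasure G) (φ : C_c(G, ℝ≥0)) :
    ν.tilde.variationValue φ = ν.variationValue (reflect φ) := by
  refine le_antisymm (variationValue_le _ fun ψ hψ => ?_) (variationValue_le _ fun ψ hψ => ?_)
  · rw [tilde_apply, RCLike.norm_conj]
    exact ν.le_variationValue fun x => by simpa using hψ (-x)
  · have := ν.tilde.le_variationValue (φ := φ) (ψ := tildeFun ψ) fun x => by simpa using hψ (-x)
    rwa [tilde_apply, RCLike.norm_conj, tildeFun_tildeFun] at this

variable [T2Space G] [LocallyCompactSpace G] [SecondCountableTopology G]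
    [MeasurableSpace G] [BorelSpace G]

theorem integral_map_neg (m : Measure G) (φ : C_c(G, ℝ≥0)) :
    ∫ x, (φ x : ℝ) ∂m.map Neg.neg = ∫ x, (reflect φ x : ℝ) ∂m :=
  (Homeomorph.neg G).measurableEmbedding.integral_map _

instance regular_map_neg (m : Measure G) [m.Regular] : (m.map Neg.neg).Regular :=
  Measure.Regular.map (Homeomorph.neg G)

theorem regular_add (m₁ m₂ : Measure G) [IsFiniteMeasureOnCompacts m₁]
    [IsFiniteMeasureOnCompacts m₂] : (m₁ + m₂).Regular := by
  have : IsFiniteMeasureOnCompacts (m₁ + m₂) := ⟨fun K hK => by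
    rw [Measure.add_apply]
    exact ENNReal.add_lt_top.2 ⟨hK.measure_lt_top, hK.measure_lt_top⟩⟩
  have : IsLocallyFiniteMeasure (m₁ + m₂) := isLocallyFiniteMeasure_of_isFiniteMeasureOnCompacts
  infer_instance

theorem integral_variation (ν : RadonMeasure G) (φ : C_c(G, ℝ≥0)) :
    ∫ x, (φ x : ℝ) ∂ν.variation = ν.variationValue φ := by
  rw [variation, NNRealRMK.integral_rieszMeasure, coe_variationFunctional]

theorem integral_rePlus (ν : RadonMeasure G) (φ : C_c(G, ℝ≥0)) :
    ∫ x, (φ x : ℝ) ∂ν.rePlus = ν.variationValue φ + (ν (toComplex φ)).re := by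
  rw [rePlus, NNRealRMK.integral_rieszMeasure, coe_shiftedFunctional, one_mul]

theorem integral_imPlus (ν : RadonMeasure G) (φ : C_c(G, ℝ≥0)) :
    ∫ x, (φ x : ℝ) ∂ν.imPlus = ν.variationValue φ + (ν (toComplex φ)).im := by
  rw [imPlus, NNRealRMK.integral_rieszMeasure, coe_shiftedFunctional]
  simp

theorem variation_tilde (ν : RadonMeasure G) : ν.tilde.variation = ν.variation.map Neg.neg := by
  refine Measure.ext_of_integral_eq_on_compactlySupported_nnreal fun φ => ?_
  rw [integral_map_neg, integral_variation, integral_variation, variationValue_tilde]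

theorem rePlus_tilde (ν : RadonMeasure G) : ν.tilde.rePlus = ν.rePlus.map Neg.neg := by
  refine Measure.ext_of_integral_eq_on_compactlySupported_nnreal fun φ => ?_
  rw [integral_map_neg, integral_rePlus, integral_rePlus, variationValue_tilde, tilde_toComplex,
    Complex.conj_re]

/-- Conjugation reverses the sign of the imaginary part, so |ν| + Im ν is not simply reflected,
unlike the other two parts. Adding the reflected part cancels the imaginary contributions, and the
additive form avoids subtracting measures. -/
theorem imPlus_tilde (ν : RadonMeasure G) :
    ν.tilde.imPlus + ν.imPlus.map Neg.neg =
      ν.variation.map Neg.neg + ν.variation.map Neg.neg := by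
  have := regular_add ν.tilde.imPlus (ν.imPlus.map Neg.neg)
  have := regular_add (ν.variation.map Neg.neg) (ν.variation.map Neg.neg)
  refine Measure.ext_of_integral_eq_on_compactlySupported_nnreal fun φ => ?_
  have hint : ∀ (m : Measure G) [m.Regular], Integrable (fun x => (φ x : ℝ)) m := fun m _ =>
    Continuous.integrable_of_hasCompactSupport (by fun_prop)
      (φ.hasCompactSupport.comp_left (g := fun r : ℝ≥0 => (r : ℝ)) (by simp))
  rw [integral_add_measure (hint _) (hint _), integral_add_measure (hint _) (hint _),
    integral_map_neg, integral_map_neg, integral_imPlus, integral_imPlus, integral_variation,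
    variationValue_tilde, tilde_toComplex, Complex.conj_im]
  ring

theorem setIntegral_neg_map_neg (m : Measure G) (S : Set G) (h : G → ℂ) :
    ∫ x in -S, h x ∂m.map Neg.neg = ∫ x in S, h (-x) ∂m := by
  have := (Homeomorph.neg G).measurableEmbedding.setIntegral_map (μ := m) h (-S)
  rw [show (Homeomorph.neg G) ⁻¹' (-S) = S by ext x; simp] at this
  exact this

theorem tilde_setIntegral_neg (ν : RadonMeasure G) {S : Set G} (hS : IsCompact S) {h : G → ℂ}
    (hh : Continuous h) :
    ν.tilde.setIntegral (-S) h = conj (ν.setIntegral S fun t => conj (h (-t))) := by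
  have hi : ∀ (m : Measure G) [m.Regular], Integrable h (m.restrict (-S)) := fun m _ =>
    hh.continuousOn.integrableOn_compact hS.neg
  -- Only at the level of integrals can the relation between the imaginary parts be solved for the
  -- tilde; compactness of S and continuity of h supply the integrability.
  have e : ∫ x in -S, h x ∂ν.tilde.imPlus + ∫ x in S, h (-x) ∂ν.imPlus =
      ∫ x in S, h (-x) ∂ν.variation + ∫ x in S, h (-x) ∂ν.variation := by
    rw [← setIntegral_neg_map_neg, ← setIntegral_neg_map_neg ν.variation,
      ← integral_add_measure (hi _) (hi _), ← integral_add_measure (hi _) (hi _),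
      ← Measure.restrict_add, ← Measure.restrict_add, imPlus_tilde]
  simp only [setIntegral]
  rw [variation_tilde, rePlus_tilde, setIntegral_neg_map_neg, setIntegral_neg_map_neg,
    eq_sub_of_add_eq e]
  simp only [integral_conj, map_add, map_sub, map_mul, Complex.conj_conj, Complex.conj_I]
  ring

end Tilde

end RadonMeasure

end EberleinConv

namespace EberleinConv

namespace RadonMeasure

section Averages

variable {G : Type*} [AddCommGroup G] [TopologicalSpace G] [IsTopologicalAddGroup G]
    [T2Space G] [LocallyCompactSpace G] [SecondCountableTopology G]
    [MeasurableSpace G] [BorelSpace G]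

/-! ### Eberlein averages as double integrals of φ(s - t). -/

section Fubini

theorem continuous_setIntegral_sub (m : Measure G) [IsLocallyFiniteMeasure m] {B : Set G}
    (hB : IsCompact B) (φ : C_c(G, ℂ)) : Continuous fun t => ∫ s in B, φ (s - t) ∂m :=
  continuous_parametric_integral_of_continuous
    (f := fun t s => φ (s - t)) (by simp only [Function.uncurry_def]; fun_prop) hB

theorem continuous_setIntegral_part (μ : RadonMeasure G) {B : Set G} (hB : IsCompact B)
    (φ : C_c(G, ℂ)) : Continuous fun t => μ.setIntegral B fun s => φ (s - t) := by
  simp only [setIntegral_eq_sum]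
  exact continuous_finsetSum _ fun i _ => (continuous_setIntegral_sub _ hB φ).const_mul _

theorem restrictConv_tilde (μ ν : RadonMeasure G) {B : Set G} (hB : IsCompact B) (φ : C_c(G, ℂ)) :
    restrictConv μ B ν.tilde (-B) φ =
      conj (ν.setIntegral B fun t => conj (μ.setIntegral B fun s => φ (s - t))) := by
  rw [restrictConv, tilde_setIntegral_neg ν hB]
  · simp only [sub_eq_add_neg]
  · have := (continuous_setIntegral_part μ hB φ).comp continuous_neg
    simpa [Function.comp_def, sub_neg_eq_add] using this

theorem restrictConv_tilde_eq_sum (μ ν : RadonMeasure G) {B : Set G} (hB : IsCompact B)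
    (φ : C_c(G, ℂ)) :
    restrictConv μ B ν.tilde (-B) φ = ∑ i, ∑ j, conj (partCoeff i) * partCoeff j *
      ∫ t in B, ∫ s in B, φ (s - t) ∂μ.part j ∂ν.part i := by
  rw [restrictConv_tilde μ ν hB, setIntegral_eq_sum, map_sum]
  refine Finset.sum_congr rfl fun i _ => ?_
  rw [map_mul, integral_conj, Complex.conj_conj]
  simp only [setIntegral_eq_sum]
  rw [integral_finsetSum _ fun j _ => ?_, Finset.mul_sum]
  · simp only [integral_const_mul, mul_assoc]
  · exact ((continuous_setIntegral_sub _ hB φ).const_mul _).continuousOn.integrableOn_compact hB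

theorem setIntegral_setIntegral_sub_swap (m₁ m₂ : Measure G) [IsLocallyFiniteMeasure m₁]
    [IsLocallyFiniteMeasure m₂] {B : Set G} (hB : IsCompact B) (φ : C_c(G, ℂ)) :
    ∫ t in B, ∫ s in B, φ (s - t) ∂m₁ ∂m₂ = ∫ s in B, ∫ t in B, φ (s - t) ∂m₂ ∂m₁ := by
  refine integral_integral_swap (f := fun t s => φ (s - t)) ?_
  rw [Measure.prod_restrict]
  refine ContinuousOn.integrableOn_compact (hB.prod hB) (Continuous.continuousOn ?_)
  simp only [Function.uncurry_def]
  fun_prop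

/-- Fubini on B × B for each pair of positive parts, with conj(φ(t - s)) being the tilde of φ at s -
t. This reduces the second Eberlein convolution to the first. -/
theorem restrictConv_swap (μ ν : RadonMeasure G) {B : Set G} (hB : IsCompact B) (φ : C_c(G, ℂ)) :
    restrictConv ν B μ.tilde (-B) φ =
      conj (restrictConv μ B ν.tilde (-B) (tildeFun φ)) := by
  have e : ∀ i j, ∫ t in B, ∫ s in B, tildeFun φ (s - t) ∂μ.part j ∂ν.part i =
      conj (∫ t in B, ∫ s in B, φ (s - t) ∂ν.part i ∂μ.part j) := by
    intro i j
    rw [setIntegral_setIntegral_sub_swap (ν.part i) (μ.part j) hB φ]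
    simp only [← integral_conj, tildeFun_apply, neg_sub]
  rw [restrictConv_tilde_eq_sum ν μ hB, restrictConv_tilde_eq_sum μ ν hB]
  simp only [e, map_sum, map_mul, Complex.conj_conj]
  rw [Finset.sum_comm]
  exact Finset.sum_congr rfl fun i _ => Finset.sum_congr rfl fun j _ => by ring

end Fubini

/-! ### Averages against Radon measures, and the vanishing of the Eberlein convolutions. -/

variable {θ : Measure G} [θ.IsAddHaarMeasure] {A : ℕ → Set G}

theorem convFun_eq_sum (φ : C_c(G, ℂ)) (μ : RadonMeasure G) (t : G) :
    convFun φ μ t = ∑ i, partCoeff i * ∫ s, φ (t - s) ∂μ.part i := by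
  rw [convFun, integral_eq_sum]

theorem IsTranslationBounded.isBddMeas_convFun {ν : RadonMeasure G} (hν : ν.IsTranslationBounded)
    (ψ : C_c(G, ℂ)) : IsBddMeas (convFun ψ ν) := by
  rw [funext (convFun_eq_sum ψ ν)]
  refine IsBddMeas.finsetSum _ fun i _ => (IsBddMeas.const _).mul ⟨?_, ?_⟩
  · have : Continuous (Function.uncurry fun t s => ψ (t - s)) := by
      simp only [Function.uncurry_def]; fun_prop
    exact this.stronglyMeasurable.integral_prod_right.measurable
  · exact exists_norm_integral_convolution_le (hν.part i) ψ

/-- The average of a function against a Radon measure over the `n`-th averaging set. -/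
noncomputable def average (θ : Measure G) (A : ℕ → Set G) (ν : RadonMeasure G) (h : G → ℂ)
    (n : ℕ) : ℂ := (θ.real (A n) : ℂ)⁻¹ * ν.setIntegral (A n) h

theorem average_eq_sum (ν : RadonMeasure G) (h : G → ℂ) (n : ℕ) :
    average θ A ν h n =
      ∑ i, partCoeff i * ((θ.real (A n) : ℂ)⁻¹ * ∫ x in A n, h x ∂ν.part i) := by
  rw [average, setIntegral_eq_sum, Finset.mul_sum]
  exact Finset.sum_congr rfl fun i _ => mul_left_comm _ _ _

theorem average_sub (ν : RadonMeasure G) {h k : G → ℂ} {n : ℕ}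
    (hh : ∀ i, IntegrableOn h (A n) (ν.part i)) (hk : ∀ i, IntegrableOn k (A n) (ν.part i)) :
    average θ A ν (fun x => h x - k x) n = average θ A ν h n - average θ A ν k n := by
  simp only [average_eq_sum, ← Finset.sum_sub_distrib]
  refine Finset.sum_congr rfl fun i _ => ?_
  rw [integral_sub (hh i) (hk i)]
  ring

theorem average_const_mul (ν : RadonMeasure G) (c : ℂ) (h : G → ℂ) (n : ℕ) :
    average θ A ν (fun x => c * h x) n = c * average θ A ν h n := by
  simp only [average_eq_sum, integral_const_mul, Finset.mul_sum]
  exact Finset.sum_congr rfl fun i _ => by ring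

theorem tendsto_average_of_parts {ν : RadonMeasure G} {h : ℕ → G → ℂ}
    (hp : ∀ i, Tendsto (fun n => (θ.real (A n))⁻¹ * ‖∫ x in A n, h n x ∂ν.part i‖) atTop (𝓝 0)) :
    Tendsto (fun n => average θ A ν (h n) n) atTop (𝓝 0) := by
  simp only [average_eq_sum]
  rw [← Finset.sum_const_zero (s := (Finset.univ : Finset (Fin 3)))]
  refine tendsto_finsetSum _ fun i _ => ?_
  rw [← mul_zero (partCoeff i)]
  refine Tendsto.const_mul _ (tendsto_zero_iff_norm_tendsto_zero.2 ((hp i).congr fun n => ?_))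
  rw [norm_mul, norm_inv, Complex.norm_real, Real.norm_of_nonneg measureReal_nonneg]

/-- Averages of uniformly small functions are uniformly small. -/
theorem IsTranslationBounded.exists_norm_average_le (hA : IsVanHove θ A) {ν : RadonMeasure G}
    (hν : ν.IsTranslationBounded) :
    ∃ C : ℝ, 0 ≤ C ∧ ∀ᶠ n in atTop, ∀ (h : G → ℂ) (ε : ℝ), 0 ≤ ε → (∀ x, ‖h x‖ ≤ ε) →
      ‖average θ A ν h n‖ ≤ C * ε := by
  choose C hC0 hC using fun i => hA.eventually_measure_le (hν.part i)
  refine ⟨∑ i, ‖partCoeff i‖ * C i,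
    Finset.sum_nonneg fun i _ => mul_nonneg (norm_nonneg _) (hC0 i), ?_⟩
  filter_upwards [eventually_all.2 hC] with n hn h ε hε hh
  rw [average_eq_sum, Finset.sum_mul]
  refine (norm_sum_le _ _).trans (Finset.sum_le_sum fun i _ => ?_)
  rw [norm_mul, norm_mul, norm_inv, Complex.norm_real, Real.norm_of_nonneg measureReal_nonneg,
    mul_assoc]
  refine mul_le_mul_of_nonneg_left ?_ (norm_nonneg _)
  calc _ ≤ (θ.real (A n))⁻¹ * (ε * (ν.part i).real (A n)) := by
        gcongr
        exact norm_setIntegral_le_of_norm_le_const (hA.isCompact n).measure_lt_top fun x _ => hh x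
    _ = (θ.real (A n))⁻¹ * (ν.part i).real (A n) * ε := by ring
    _ ≤ C i * ε := by gcongr; exact hn i

/-- In the mean, a convolution can be moved from the measure to the function. -/
theorem tendsto_mean_mul_convFun_sub (hA : IsVanHove θ A) {ν : RadonMeasure G}
    (hν : ν.IsTranslationBounded) (ψ : C_c(G, ℂ)) {F : G → ℂ} (hF : Continuous F) {M : ℝ}
    (hFM : ∀ x, ‖F x‖ ≤ M) :
    Tendsto (fun n => mean θ A (fun t => F t * convFun ψ ν t) n -
      average θ A ν (fun s => ∫ t, F t * ψ (t - s) ∂θ) n) atTop (𝓝 0) := by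
  have hFb : IsBddMeas F := ⟨hF.measurable, M, hFM⟩
  have hcont : Continuous (Function.uncurry fun t s => ψ (t - s)) := by
    simp only [Function.uncurry_def]; fun_prop
  have hconv : ∀ i, IsBddMeas fun t => ∫ s, ψ (t - s) ∂ν.part i := fun i =>
    ⟨hcont.stronglyMeasurable.integral_prod_right.measurable,
      exists_norm_integral_convolution_le (hν.part i) ψ⟩
  have e : ∀ n, mean θ A (fun t => F t * convFun ψ ν t) n -
      average θ A ν (fun s => ∫ t, F t * ψ (t - s) ∂θ) n =
      ∑ i, partCoeff i * ((θ.real (A n) : ℂ)⁻¹ *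
        ((∫ t in A n, F t * ∫ s, ψ (t - s) ∂ν.part i ∂θ) -
          ∫ s in A n, ∫ t, F t * ψ (t - s) ∂θ ∂ν.part i)) := by
    intro n
    have e1 : (fun t => F t * convFun ψ ν t) =
        fun t => ∑ i, partCoeff i * (F t * ∫ s, ψ (t - s) ∂ν.part i) := by
      ext t
      rw [convFun_eq_sum, Finset.mul_sum]
      exact Finset.sum_congr rfl fun i _ => mul_left_comm _ _ _
    rw [e1, mean_finsetSum hA _ fun i _ => (IsBddMeas.const _).mul (hFb.mul (hconv i)),
      average_eq_sum, ← Finset.sum_sub_distrib]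
    refine Finset.sum_congr rfl fun i _ => ?_
    rw [mean_const_mul, mean_eq_mul]
    ring
  simp only [e]
  rw [← Finset.sum_const_zero (s := (Finset.univ : Finset (Fin 3)))]
  refine tendsto_finsetSum _ fun i _ => ?_
  rw [← mul_zero (partCoeff i)]
  refine Tendsto.const_mul _ ?_
  obtain ⟨C, -, hC⟩ := exists_norm_sub_convolution_le θ (hν.part i) ψ hF hFM
  have hlim : Tendsto (fun n => C * (θ.real (kBoundary (tsupport ψ) (A n)) / θ.real (A n) +
      θ.real (kBoundary (-tsupport ψ) (A n)) / θ.real (A n))) atTop (𝓝 0) := by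
    simpa using ((hA.tendsto_boundary _ ψ.hasCompactSupport).add
      (hA.tendsto_boundary _ (IsCompact.neg ψ.hasCompactSupport))).const_mul C
  refine squeeze_zero_norm (fun n => ?_) hlim
  rw [norm_mul, norm_inv, Complex.norm_real, Real.norm_of_nonneg measureReal_nonneg]
  calc _ ≤ (θ.real (A n))⁻¹ * (C * (θ.real (kBoundary (tsupport ψ) (A n)) +
        θ.real (kBoundary (-tsupport ψ) (A n)))) := by gcongr; exact hC (A n) (hA.isCompact n)
    _ = _ := by ring

/-- The Fourier–Bohr averages of `ψ * ν` are asymptotic to those of `ν` times the Fourier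
transform of `ψ`. -/
theorem tendsto_mean_char_mul_convFun_sub (hA : IsVanHove θ A) {ν : RadonMeasure G}
    (hν : ν.IsTranslationBounded) (ψ : C_c(G, ℂ)) (χ : Dual G) :
    Tendsto (fun n => mean θ A (fun t => conj (charFun χ t) * convFun ψ ν t) n -
      (∫ t, conj (charFun χ t) * ψ t ∂θ) * average θ A ν (fun t => conj (charFun χ t)) n)
      atTop (𝓝 0) := by
  have h := tendsto_mean_mul_convFun_sub hA hν ψ (F := fun t => conj (charFun χ t))
    (Complex.continuous_conj.comp (continuous_charFun χ)) (M := 1)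
    (fun x => by rw [RCLike.norm_conj, norm_charFun])
  refine h.congr fun n => ?_
  congr 1
  rw [← average_const_mul]
  congr 1
  ext s
  -- Invariance of θ extracts conj(χ(s)) from ∫ conj(χ(t)) ψ(t - s) dt, leaving the Fourier
  -- transform of ψ.
  rw [← integral_sub_right_eq_self (fun t => conj (charFun χ t) * ψ t) s, ← integral_mul_const]
  congr 1
  ext t
  conv_lhs => rw [← sub_add_cancel t s, charFun_add, map_mul, sub_add_cancel]
  ring

theorem tendsto_mean_char_mul_convFun_zero (hA : IsVanHove θ A) {ν : RadonMeasure G}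
    (hν : ν.IsTranslationBounded) (ψ : C_c(G, ℂ)) {χ : Dual G}
    (h : ν.HasFourierBohrCoeff θ A χ 0) :
    Tendsto (mean θ A fun t => conj (charFun χ t) * convFun ψ ν t) atTop (𝓝 0) := by
  have h1 := tendsto_mean_char_mul_convFun_sub hA hν ψ χ
  have h2 : Tendsto (average θ A ν fun t => conj (charFun χ t)) atTop (𝓝 0) := h
  simpa using h1.add (h2.const_mul (∫ t, conj (charFun χ t) * ψ t ∂θ))

/-- The averages of φ * μ are asymptotically a times those of μ, where a is the Fourier transform of
φ at χ. A non-zero limit forces a ≠ 0, and dividing by a yields existence of the coefficient of μ as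
well. -/
theorem mem_fourierBohrSpectrum_of_convFun (hA : IsVanHove θ A) {μ : RadonMeasure G}
    (hμ : μ.IsTranslationBounded) (φ : C_c(G, ℂ)) {χ : Dual G} {c : ℂ} (hc : c ≠ 0)
    (h : Tendsto (mean θ A fun t => convFun φ μ t * conj (charFun χ t)) atTop (𝓝 c)) :
    χ ∈ μ.fourierBohrSpectrum θ A := by
  have h1 := tendsto_mean_char_mul_convFun_sub hA hμ φ χ
  simp only [mul_comm (convFun φ μ _)] at h
  set a := ∫ t, conj (charFun χ t) * φ t ∂θ
  have h2 : Tendsto (fun n => a * average θ A μ (fun t => conj (charFun χ t)) n) atTop (𝓝 c) := by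
    simpa using h.sub h1
  have ha : a ≠ 0 := by
    intro h0
    rw [h0] at h2
    simp only [zero_mul] at h2
    exact hc (tendsto_nhds_unique h2 tendsto_const_nhds)
  refine ⟨a⁻¹ * c, mul_ne_zero (inv_ne_zero ha) hc, ?_⟩
  refine (h2.const_mul a⁻¹).congr fun n => ?_
  rw [inv_mul_cancel_left₀ ha, average]

/-- Restricting the inner measure to the averaging sets does not change the averages
asymptotically. -/
theorem tendsto_average_restrict_sub (hA : IsVanHove θ A) {μ ν : RadonMeasure G}
    (hμ : μ.IsTranslationBounded) (hν : ν.IsTranslationBounded) (φ : C_c(G, ℂ)) :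
    Tendsto (fun n => average θ A ν (fun t => conj (μ.setIntegral (A n) (fun s => φ (s - t))) -
      conj (convFun (reflect φ) μ t)) n) atTop (𝓝 0) := by
  set K := tsupport φ
  have hK : IsCompact K := φ.hasCompactSupport
  have hφ0 : ∀ x, x ∉ K → φ x = 0 := fun x hx => image_eq_zero_of_notMem_tsupport hx
  obtain ⟨N, hN, hφ⟩ := exists_norm_le φ
  have hconv : ∀ t, convFun (reflect φ) μ t = μ.setIntegral Set.univ fun s => φ (s - t) := by
    intro t
    simp [convFun, integral]
  -- One bound for all S covers both the truncated and the full integral, whence the factor 2D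
  -- below.
  have hbd : ∃ D : ℝ, 0 ≤ D ∧ ∀ S t, ‖μ.setIntegral S fun s => φ (s - t)‖ ≤ D := by
    choose C hC using fun j => hμ.part j (-(-K)) hK.neg.neg
    refine ⟨∑ j, ‖partCoeff j‖ * (N * C j), by positivity, fun S t => ?_⟩
    rw [setIntegral_eq_sum]
    refine (norm_sum_le _ _).trans (Finset.sum_le_sum fun j _ => ?_)
    rw [norm_mul]
    refine mul_le_mul_of_nonneg_left ?_ (norm_nonneg _)
    refine TranslationBounded.norm_integral_le (m := (μ.part j).restrict S) (K := -K) (t := t)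
      hK.neg (fun t => (Measure.restrict_apply_le _ _).trans (hC j t)) hN (fun s hs => ?_)
      fun s => hφ _
    exact hφ0 _ fun h => hs (by simpa using h)
  obtain ⟨D, hD, hbd⟩ := hbd
  refine tendsto_average_of_parts fun i => ?_
  have hlim := (hA.tendsto_inner_boundary (hν.part i) hK).const_mul (2 * D)
  rw [mul_zero] at hlim
  refine squeeze_zero (fun n => by positivity) (fun n => ?_) hlim
  have hAn := hA.isCompact n
  have hAm := hAn.isClosed.measurableSet
  have hopen : IsOpen ((A n)ᶜ - K) := hAn.isClosed.isOpen_compl.sub_right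
  set B := ((A n)ᶜ - K) ∩ A n
  have hBfin : (ν.part i) B < ∞ :=
    (measure_mono Set.inter_subset_right).trans_lt hAn.measure_lt_top
  -- Away from the inner boundary t + K is contained in A_n, so the truncation loses nothing.
  have h0 : ∀ t ∈ A n \ B, conj (μ.setIntegral (A n) (fun s => φ (s - t))) -
      conj (convFun (reflect φ) μ t) = 0 := by
    intro t ht
    rw [hconv, sub_eq_zero]
    congr 1
    simp only [setIntegral_eq_sum, Measure.restrict_univ]
    refine Finset.sum_congr rfl fun j _ => ?_
    rw [setIntegral_eq_integral_of_forall_compl_eq_zero]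
    intro s hs
    refine hφ0 _ fun h => ht.2 ⟨⟨s, hs, s - t, h, by simp⟩, ht.1⟩
  have hBA : B ⊆ A n := Set.inter_subset_right
  rw [setIntegral_eq_of_subset_of_forall_sdiff_eq_zero hAm hBA h0]
  calc _ ≤ (θ.real (A n))⁻¹ * (2 * D * (ν.part i).real B) := by
        gcongr
        refine norm_setIntegral_le_of_norm_le_const hBfin fun t _ => ?_
        refine (norm_sub_le _ _).trans ?_
        rw [RCLike.norm_conj, RCLike.norm_conj, hconv]
        linarith [hbd (A n) t, hbd Set.univ t]
    _ = _ := by ring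

/-- Approximate units in `C_c`. -/
theorem exists_approximate_unit (θ : Measure G) [θ.IsAddHaarMeasure] {U : Set G}
    (hU : U ∈ 𝓝 (0 : G)) :
    ∃ ψ : C_c(G, ℂ), (∀ x, x ∉ U → ψ x = 0) ∧ ∫ x, ψ x ∂θ = 1 ∧ ∫ x, ‖ψ x‖ ∂θ = 1 := by
  obtain ⟨f, hf1, hf2, hf3, hf4⟩ := exists_continuousMap_one_of_isCompact_subset_isOpen
    (isCompact_singleton (x := (0 : G))) isOpen_interior
    (Set.singleton_subset_iff.2 (mem_interior_iff_mem_nhds.2 hU))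
  have hcs : HasCompactSupport f := hasCompactSupport_def.mpr hf2
  have hpos : 0 < ∫ x, f x ∂θ := by
    refine (map_continuous f).integral_pos_of_hasCompactSupport_nonneg_nonzero hcs
      (fun x => (hf4 x).1) (x := 0) ?_
    rw [hf1 rfl]
    exact one_ne_zero
  set I := ∫ x, f x ∂θ
  let ψ : C_c(G, ℂ) := ⟨⟨fun x => ((f x / I : ℝ) : ℂ), by fun_prop⟩,
    hcs.comp_left (g := fun r : ℝ => ((r / I : ℝ) : ℂ)) (by simp)⟩
  have hψ : ∀ x, ψ x = ((f x / I : ℝ) : ℂ) := fun x => rfl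
  refine ⟨ψ, fun x hx => ?_, ?_, ?_⟩
  · have : f x = 0 := image_eq_zero_of_notMem_tsupport fun h => hx (interior_subset (hf3 h))
    simp [hψ, this]
  · simp only [hψ]
    rw [integral_complex_ofReal, integral_div, div_self hpos.ne', Complex.ofReal_one]
  · simp only [hψ, Complex.norm_real]
    have : ∀ x, ‖f x / I‖ = f x / I := fun x =>
      Real.norm_of_nonneg (div_nonneg (hf4 x).1 hpos.le)
    simp only [this]
    rw [integral_div, div_self hpos.ne']

/-- ψ(t - s) dt has total mass and total variation 1 and vanishes for t outside s + U, where F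
varies by at most ε from F(s). -/
theorem norm_integral_mul_sub_le {F : G → ℂ} (hF : IsBddMeas F) {U : Set G} {ε : ℝ}
    (hU : ∀ x y, x - y ∈ U → ‖F x - F y‖ ≤ ε) {ψ : C_c(G, ℂ)} (hψU : ∀ x, x ∉ U → ψ x = 0)
    (hψ1 : ∫ x, ψ x ∂θ = 1) (hψ2 : ∫ x, ‖ψ x‖ ∂θ = 1) (s : G) :
    ‖(∫ t, F t * ψ (t - s) ∂θ) - F s‖ ≤ ε := by
  have hψi : Integrable (fun t => ψ (t - s)) θ :=
    ((map_continuous ψ).integrable_of_hasCompactSupport ψ.hasCompactSupport).comp_sub_right s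
  obtain ⟨C, hC⟩ := hF.2
  have hi : Integrable (fun t => F t * ψ (t - s)) θ :=
    hψi.bdd_mul hF.1.aestronglyMeasurable (Eventually.of_forall hC)
  have e : (∫ t, F t * ψ (t - s) ∂θ) - F s = ∫ t, (F t - F s) * ψ (t - s) ∂θ := by
    simp only [sub_mul]
    rw [integral_sub hi (hψi.const_mul _), integral_const_mul,
      integral_sub_right_eq_self (fun t => ψ t) s, hψ1, mul_one]
  rw [e]
  calc _ ≤ ∫ t, ε * ‖ψ (t - s)‖ ∂θ := by
        refine norm_integral_le_of_norm_le (hψi.norm.const_mul _) (Eventually.of_forall fun t => ?_)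
        rw [norm_mul]
        by_cases h : t - s ∈ U
        · exact mul_le_mul_of_nonneg_right (hU t s h) (norm_nonneg _)
        · simp [hψU _ h]
    _ = ε := by
        rw [integral_const_mul, integral_sub_right_eq_self (fun t => ‖ψ t‖) s, hψ2, mul_one]

/-- The orthogonality result concerns two functions, whereas ν is a measure. Smoothing conj(φ * μ)
by ψ and shifting ψ onto ν bridges the gap, at a uniform error δ that the averages against ν amplify
at most by the fixed factor C. -/
theorem tendsto_average_conj_convFun (hA : IsVanHove θ A) {μ ν : RadonMeasure G}
    (hμ : μ.IsTranslationBounded) (hμA : μ.IsBesicovitch θ A) (hν : ν.IsTranslationBounded)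
    (h : ∀ χ ∈ μ.fourierBohrSpectrum θ A, ν.HasFourierBohrCoeff θ A χ 0) (φ : C_c(G, ℂ)) :
    Tendsto (average θ A ν fun t => conj (convFun φ μ t)) atTop (𝓝 0) := by
  have hf := hμA φ
  have hfm := hf.1.isBddMeas
  have hFc : Continuous fun t => conj (convFun φ μ t) :=
    Complex.continuous_conj.comp hf.1.continuous
  obtain ⟨C, hC0, hC⟩ := hν.exists_norm_average_le hA
  obtain ⟨M, hM⟩ := hfm.conjugate.2
  rw [Metric.tendsto_nhds]
  intro ε hε
  set δ := ε / (2 * (C + 1)) with hδ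
  have hδ0 : 0 < δ := by positivity
  obtain ⟨U, hU0, hU⟩ := hf.1.2 δ hδ0
  obtain ⟨ψ, hψU, hψ1, hψ2⟩ := exists_approximate_unit θ hU0
  have happrox := norm_integral_mul_sub_le (θ := θ) hfm.conjugate (U := U) (ε := δ)
    (fun x y hxy => by rw [← map_sub, RCLike.norm_conj]; exact (hU x y hxy).le) hψU hψ1 hψ2
  set F' : G → ℂ := fun s => ∫ t, conj (convFun φ μ t) * ψ (t - s) ∂θ with hF'
  have hF'm : IsBddMeas F' := by
    refine ⟨?_, δ + M, fun s => ?_⟩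
    · have : Continuous (Function.uncurry fun s t => conj (convFun φ μ t) * ψ (t - s)) := by
        have := hFc.comp (continuous_snd (X := G) (Y := G))
        simp only [Function.uncurry_def]
        exact this.mul (by fun_prop)
      exact this.stronglyMeasurable.integral_prod_right.measurable
    · have h1 := norm_le_norm_sub_add (F' s) (conj (convFun φ μ s))
      exact h1.trans (add_le_add (happrox s) (hM s))
  have h1 := tendsto_mean_mul_convFun_sub hA hν ψ hFc hM
  have h2 : Tendsto (mean θ A fun t => conj (convFun φ μ t) * convFun ψ ν t) atTop (𝓝 0) :=
    -- A frequency of φ * μ lies in the spectrum of μ, where the coefficient of ν, and hence that of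
    -- ψ * ν, is zero.
    hf.tendsto_mean_conj_mul hA (hν.isBddMeas_convFun ψ) fun χ c hc hχ =>
      tendsto_mean_char_mul_convFun_zero hA hν ψ
        (h χ (mem_fourierBohrSpectrum_of_convFun hA hμ φ hc hχ))
  have h3 : Tendsto (average θ A ν F') atTop (𝓝 0) := by simpa using h2.sub h1
  filter_upwards [hC, (Metric.tendsto_nhds.1 h3) (ε / 2) (by positivity)] with n hn1 hn2
  rw [dist_zero_right] at hn2 ⊢
  have h4 := hn1 _ δ hδ0.le happrox
  have hfin := fun i => (hA.isCompact n).measure_lt_top (μ := ν.part i)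
  rw [average_sub ν (fun i => hF'm.integrableOn (hfin i))
    (fun i => hfm.conjugate.integrableOn (hfin i)), norm_sub_rev] at h4
  have h5 := norm_le_norm_sub_add (average θ A ν (fun t => conj (convFun φ μ t)) n)
    (average θ A ν F' n)
  have h6 : C * δ ≤ ε / 2 := by
    rw [hδ, mul_div_assoc', div_le_div_iff₀ (by positivity) (by positivity)]
    nlinarith
  linarith

/-- The reflected test function appears because ∫ φ(s - t) dμ(s) is the convolution of μ with φ(-·)
at t. -/
theorem hasEberleinConv_tilde_zero (hA : IsVanHove θ A) {μ ν : RadonMeasure G}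
    (hμ : μ.IsTranslationBounded) (hμA : μ.IsBesicovitch θ A) (hν : ν.IsTranslationBounded)
    (h : ∀ χ ∈ μ.fourierBohrSpectrum θ A, ν.HasFourierBohrCoeff θ A χ 0) :
    μ.HasEberleinConv θ A ν.tilde 0 := by
  intro φ
  have h1 := tendsto_average_restrict_sub hA hμ hν φ
  have h2 := tendsto_average_conj_convFun hA hμ hμA hν h (reflect φ)
  have h3 := (Complex.continuous_conj.tendsto _).comp (h1.add h2)
  rw [add_zero, map_zero] at h3
  rw [zero_apply]
  refine h3.congr fun n => ?_
  have hin : Continuous fun t => conj (μ.setIntegral (A n) fun s => φ (s - t)) :=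
    Complex.continuous_conj.comp (continuous_setIntegral_part μ (hA.isCompact n) φ)
  have hout : Continuous fun t => conj (convFun (reflect φ) μ t) :=
    Complex.continuous_conj.comp (hμA (reflect φ)).1.continuous
  rw [Function.comp_apply, average_sub ν
    (fun i => hin.continuousOn.integrableOn_compact (hA.isCompact n))
    (fun i => hout.continuousOn.integrableOn_compact (hA.isCompact n)), sub_add_cancel, average,
    restrictConv_tilde μ ν (hA.isCompact n), map_mul, map_inv₀, Complex.conj_ofReal]

theorem hasEberleinConv_swap (hA : IsVanHove θ A) {μ ν : RadonMeasure G}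
    (h : μ.HasEberleinConv θ A ν.tilde 0) : ν.HasEberleinConv θ A μ.tilde 0 := by
  intro φ
  have h1 := (Complex.continuous_conj.tendsto _).comp (h (tildeFun φ))
  rw [zero_apply, map_zero] at h1
  rw [zero_apply]
  refine h1.congr fun n => ?_
  rw [restrictConv_swap μ ν (hA.isCompact n)]
  simp

end Averages

end RadonMeasure

end EberleinConv

theorem mainTheorem6 {G : Type*} [AddCommGroup G] [TopologicalSpace G] [IsTopologicalAddGroup G]
    [T2Space G] [LocallyCompactSpace G] [SecondCountableTopology G]
    [MeasurableSpace G] [BorelSpace G]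
    (θ : MeasureTheory.Measure G) [θ.IsAddHaarMeasure]
    (A : ℕ → Set G) (hA : EberleinConv.IsVanHove θ A)
    (μ : EberleinConv.RadonMeasure G) (hμ : μ.IsTranslationBounded)
    (hμA : μ.IsBesicovitch θ A) :
    (∀ ν : EberleinConv.RadonMeasure G, ν.IsTranslationBounded →
      (∀ χ ∈ μ.fourierBohrSpectrum θ A, ν.HasFourierBohrCoeff θ A χ 0) →
        μ.HasEberleinConv θ A ν.tilde 0 ∧ ν.HasEberleinConv θ A μ.tilde 0) ∧
    (∀ ν : EberleinConv.RadonMeasure G, ν.IsTranslationBounded →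
      ν.HasNullFourierBohrSpectrum θ A →
        μ.HasEberleinConv θ A ν.tilde 0 ∧ ν.HasEberleinConv θ A μ.tilde 0) := by
  have key : ∀ ν : EberleinConv.RadonMeasure G, ν.IsTranslationBounded →
      (∀ χ ∈ μ.fourierBohrSpectrum θ A, ν.HasFourierBohrCoeff θ A χ 0) →
        μ.HasEberleinConv θ A ν.tilde 0 ∧ ν.HasEberleinConv θ A μ.tilde 0 := fun ν hν h =>
    have h1 := EberleinConv.RadonMeasure.hasEberleinConv_tilde_zero hA hμ hμA hν h
    ⟨h1, EberleinConv.RadonMeasure.hasEberleinConv_swap hA h1⟩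
  refine ⟨key, fun ν hν hnull => key ν hν fun χ _ => ?_⟩
  obtain ⟨c, hc⟩ := hnull.1 χ
  -- A non-zero coefficient would belong to the spectrum of ν, which is empty.
  by_cases h0 : c = 0
  · rwa [h0] at hc
  · have : χ ∈ ν.fourierBohrSpectrum θ A := ⟨c, h0, hc⟩
    rw [hnull.2] at this
    exact this.elim
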